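/- Let $V\subset\mathbb{C}^3$ be such that, near the origin, $V$ is the zero set of $f=z^m+c_{m-1}(x,y)z^{m-1}+\dots+c_0(x,y)$, where the $c_i$ are convergent power series with $c_i(0,0)=0$ and the discriminant of $f$ with respect to $z$ is $x^ay^b\epsilon(x,y)$ with $\epsilon(0,0)\ne0$. A fractional power series $\zeta=H(x^{1/n},y^{1/n})$ ($n\ge1$, $H$ a convergent power series) is called a parametrization of $(V,0)$ if, for such an $f$, $f=\prod_i(z-\zeta_i)$, where the $\zeta_i$ are the distinct conjugates $H(\omega_1x^{1/n},\omega_2y^{1/n})$ of $\zeta$ ($\omega_1^n=\omega_2^n=1$). The characteristic pairs of $\zeta$ are the distinct pairs $(u/n,v/n)$ such that $\zeta_i-\zeta_j=x^{u/n}y^{v/n}\epsilon_{ij}(x^{1/n},y^{1/n})$ with $\epsilon_{ij}(0,0)\neq0$ for some $\zeta_i\ne\zeta_j$. The parametrization $\zeta$ is called normalized if $\zeta=x^{a/n}y^{b/n}G(x^{1/n},y^{1/n})$ with $G(0,0)\ne0$ such that 1. $a$ and $b$ are not both divisible by $n$; 2. if $a+b<n$, then $a>0$ and $b>0$; 3.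 the characteristic pairs can be labeled $(\lambda_i,\mu_i)_{1\le i\le s}$ so that $\lambda_1\le\dots\le\lambda_s$ and $\mu_1\le\dots\le\mu_s$, and then $(\lambda_1,\dots,\lambda_s)\ge(\mu_1,\dots,\mu_s)$ lexicographically. Lemma. Let $\zeta$ be a parametrization of such a germ $(V,0)$, and suppose that $V$ is singular (not smooth) at the origin. Then there is a finite sequence of coordinate changes, each of one of the types (i) $x'=x,\ y'=y,\ z'=z-p(x,y)$, where $p$ is the sum of all terms of the current parametrization in which both exponents are integers, the new parametrization being the current one minus $p$; (ii) $x'=z,\ y'=y,\ z'=x$, the new parametrization being some parametrization of the image germ; (iii) $x'=y,\ y'=x,\ z'=z$, the new parametrization being the current one with $x$ and $y$ exchanged; such that after each change the image of $V$ is again a germ of the above kind (in the new coordinates) with the new series as a parametrization, and the parametrization obtained at the end is normalized. -/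

import Mathlib

open Filter Topology

noncomputable section

namespace QuasiOrdinary

/-- Affine three-space `ℂ³`, with coordinates `(x, y, z)`. -/
abbrev Space : Type := ℂ × ℂ × ℂ

/-- Formal power series in two variables (variable `0` is `x`, variable `1` is `y`). -/
abbrev Series : Type := MvPowerSeries (Fin 2) ℂ

/-- The series converges (absolutely) on some polydisc around the origin. -/
def Convergent (h : Series) : Prop :=
  ∃ r : ℝ, 0 < r ∧
    Summable fun d : Fin 2 →₀ ℕ => ‖MvPowerSeries.coeff d h‖ * r ^ (d 0 + d 1)

/-- The value `h(x, y)`; meaningful at points where the series converges absolutely, hence on a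
neighbourhood of the origin if `h` is convergent. -/
def value (h : Series) (x y : ℂ) : ℂ :=
  ∑' d : Fin 2 →₀ ℕ, MvPowerSeries.coeff d h * x ^ d 0 * y ^ d 1

/-- The series is `x ^ u * y ^ v * ε` with `ε(0, 0) ≠ 0`. -/
def IsMonomialTimesUnit (h : Series) (u v : ℕ) : Prop :=
  ∃ ε : Series, MvPowerSeries.constantCoeff ε ≠ 0 ∧
    h = MvPowerSeries.X 0 ^ u * MvPowerSeries.X 1 ^ v * ε

/-- The equation of a quasi-ordinary surface germ at the origin of `ℂ³`:
`f = z ^ m + c_{m-1}(x, y) z ^ (m-1) + ⋯ + c_0(x, y)` with convergent power series `c_i`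
vanishing at the origin, whose discriminant with respect to `z` is `x ^ a * y ^ b * ε(x, y)`,
`ε(0, 0) ≠ 0`. -/
structure IsQuasiOrdinary (f : Polynomial Series) : Prop where
  monic : f.Monic
  convergent : ∀ i, Convergent (f.coeff i)
  vanish : ∀ i < f.natDegree, MvPowerSeries.constantCoeff (f.coeff i) = 0
  discr : ∃ a b : ℕ, IsMonomialTimesUnit f.discr a b

/-- The set of points with `f(x, y, z) = 0`; only its germ at the origin is used. -/
def zeroLocus (f : Polynomial Series) : Set Space :=
  {q | ∑ i ∈ Finset.range (f.natDegree + 1), value (f.coeff i) q.1 q.2.1 * q.2.2 ^ i = 0}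

/-- A fractional power series `ζ = H(x^{1/n}, y^{1/n})` with `n ≥ 1`. -/
structure FracSeries where
  n : ℕ
  n_ne_zero : n ≠ 0
  H : Series

namespace FracSeries

variable (ζ : FracSeries)

open Classical in
/-- The distinct conjugates of `ζ`: the series `H(ω₁ x^{1/n}, ω₂ y^{1/n})`, where `ω₁`, `ω₂` are
`n`-th roots of unity (as power series in `x^{1/n}`, `y^{1/n}`). -/
def conjugates : Finset Series :=
  (Polynomial.nthRootsFinset ζ.n (1 : ℂ) ×ˢ Polynomial.nthRootsFinset ζ.n (1 : ℂ)).image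
    fun ω => MvPowerSeries.rescale ![ω.1, ω.2] ζ.H

/-- The characteristic pairs of `ζ`: the pairs `(u/n, v/n)` such that the difference of two distinct
conjugates is `x^{u/n} y^{v/n} ε(x^{1/n}, y^{1/n})` with `ε(0, 0) ≠ 0`. -/
def charPairs : Set (ℚ × ℚ) :=
  {q | ∃ h ∈ ζ.conjugates, ∃ h' ∈ ζ.conjugates, h ≠ h' ∧
    ∃ u v : ℕ, IsMonomialTimesUnit (h - h') u v ∧ q = ((u : ℚ) / ζ.n, (v : ℚ) / ζ.n)}

/-- The power series `p(x, y)` formed by all terms of `ζ` in which the exponents of `x` and `y` are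
both integers. -/
def integralPart : Series := fun d => MvPowerSeries.coeff (ζ.n • d) ζ.H

/-- The fractional power series `ζ - p(x, y)`, with `p` the integral part of `ζ`. -/
def subIntegralPart : FracSeries where
  n := ζ.n
  n_ne_zero := ζ.n_ne_zero
  H := ζ.H - MvPowerSeries.expand ζ.n ζ.n_ne_zero ζ.integralPart

/-- The fractional power series `H(y^{1/n}, x^{1/n})`. -/
def swap : FracSeries where
  n := ζ.n
  n_ne_zero := ζ.n_ne_zero
  H := MvPowerSeries.rename (Equiv.swap (0 : Fin 2) 1) ζ.H

/-- `ζ` is normalized: `ζ = x^{a/n} y^{b/n} G(x^{1/n}, y^{1/n})` with `G(0, 0) ≠ 0`, where `a`, `b` are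
not both divisible by `n`; if `a + b < n` then `a > 0` and `b > 0`; and, listing the distinct
characteristic pairs as `(λ_i, μ_i)` with both coordinates nondecreasing, the sequence of the `λ_i`
is lexicographically at least the sequence of the `μ_i`. -/
def IsNormalized : Prop :=
  (∃ a b : ℕ, IsMonomialTimesUnit ζ.H a b ∧
    ¬ (ζ.n ∣ a ∧ ζ.n ∣ b) ∧
    (a + b < ζ.n → 0 < a ∧ 0 < b)) ∧
  ∃ (s : ℕ) (lam mu : Fin s → ℚ),
    Monotone lam ∧ Monotone mu ∧
    Function.Injective (fun i => (lam i, mu i)) ∧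
    Set.range (fun i => (lam i, mu i)) = ζ.charPairs ∧
    toLex mu ≤ toLex lam

end FracSeries

/-- `ζ = H(x^{1/n}, y^{1/n})` is a parametrization of the quasi-ordinary surface germ `(V, 0)`:
near the origin `V` is the zero set of `f = z ^ m + ⋯ + c_0(x, y)` with normal crossings
discriminant, and `f = ∏ (z - ζ_i)`, the product being over the distinct conjugates `ζ_i` of `ζ`
(an identity of polynomials in `z` over the power series in `x^{1/n}`, `y^{1/n}`). -/
def IsParametrization (V : Set Space) (ζ : FracSeries) : Prop :=
  Convergent ζ.H ∧
  ∃ f : Polynomial Series, IsQuasiOrdinary f ∧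
    V =ᶠ[𝓝 (0 : Space)] zeroLocus f ∧
    f.map (MvPowerSeries.expand ζ.n ζ.n_ne_zero : Series →ₐ[ℂ] Series).toRingHom =
      ∏ h ∈ ζ.conjugates, (Polynomial.X - Polynomial.C h)

/-- The surface germ `(V, 0)` is smooth: near the origin `V` is the zero set of an analytic function
vanishing at the origin with nonzero differential there. -/
def IsSmoothGerm (V : Set Space) : Prop :=
  ∃ g : Space → ℂ, AnalyticAt ℂ g 0 ∧ g 0 = 0 ∧ fderiv ℂ g 0 ≠ 0 ∧
    V =ᶠ[𝓝 (0 : Space)] {q | g q = 0}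

/-- The coordinate change `x' = x`, `y' = y`, `z' = z - p(x, y)`. -/
def shear (p : Series) (q : Space) : Space := (q.1, q.2.1, q.2.2 - value p q.1 q.2.1)

/-- The coordinate change `x' = z`, `y' = y`, `z' = x`. -/
def swapXZ (q : Space) : Space := (q.2.2, q.2.1, q.1)

/-- The coordinate change `x' = y`, `y' = x`, `z' = z`. -/
def swapXY (q : Space) : Space := (q.2.1, q.1, q.2.2)

/-- One coordinate change, from a germ with a parametrization to a germ with a parametrization. -/
inductive Step : Set Space × FracSeries → Set Space × FracSeries → Prop
  | subtract (V : Set Space) (ζ : FracSeries)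
      (h : IsParametrization (shear ζ.integralPart '' V) ζ.subIntegralPart) :
      Step (V, ζ) (shear ζ.integralPart '' V, ζ.subIntegralPart)
  | exchangeXZ (V : Set Space) (ζ ζ' : FracSeries)
      (h : IsParametrization (swapXZ '' V) ζ') :
      Step (V, ζ) (swapXZ '' V, ζ')
  | exchangeXY (V : Set Space) (ζ : FracSeries)
      (h : IsParametrization (swapXY '' V) ζ.swap) :
      Step (V, ζ) (swapXY '' V, ζ.swap)

end QuasiOrdinary

end

/-!
The key point is `isParametrization_iff`: a fractional power series `ζ = H(x^{1/n}, y^{1/n})`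
parametrizes a quasi-ordinary germ `V` iff `H` converges and vanishes at the origin, all differences
`H(ω₁ t, ω₂ s) - H(t, s)` are zero or monomials times units, and `V` is near the origin the set of
points `(t ^ n, s ^ n, H(t, s))`. The discriminant of `∏ (z - ζ_i)` is up to sign the product of the
differences of its roots, and divisors of a monomial times a unit are of the same form; conversely
`∏ (z - ζ_i)` has coefficients in the power series in `x` and `y` because they are fixed by the
roots of unity. With this criterion the equation of the germ is never needed when coordinates are
changed.

If two monomials times units have a difference of the same kind, their exponents are comparable
(`IsMonomialTimesUnit.comparable`), so the characteristic pairs form a chain. Once the integral part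
has been subtracted, every term of `ζ` occurs in a difference of conjugates, and therefore `ζ` is
the monomial of the least characteristic pair times a unit, unless it vanishes, in which case `V` is
smooth. This is the first condition of normality; the third is achieved by exchanging `x` and `y`,
because the lexicographic order is total.

The second condition fails only if, after possibly exchanging `x` and `y`, the leading monomial is
`x^{a/n}` with `0 < a < n`. Write `ζ = P(t, s) ^ a` with `P = t * g(t, s)`, `g(0, 0) ≠ 0`, and let
`T` be the inverse of `P` in its first variable. Then `x = T(z^{1/a}, y^{1/n}) ^ n`
parametrizes the germ with `x` and `z` exchanged (`IsParametrization.exists_exchange`). Its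
differences of conjugates are products of terms `T(α w, β s) - γ T(w, s)`; substituting
`w = P(t, s)`, such a term divides `α P(t, s) - P(γ t, β s)`, hence
`H(t, s) - H(γ t, β s)` when the latter is not zero; when it is zero, `P(γ t, β s)` is a constant
multiple of `P(t, s)`, and the term is zero or divides a constant times `P`. All exponents of `x` in
the new parametrization are at least `n / a > 1`, so the second condition holds after subtracting
the integral part again.

The passage between formal and analytic arguments rests on the identification of convergent power
series with analytic germs (`AbsConv.analyticAt`, `exists_absConv_of_analyticAt`,
`AbsConv.eq_zero`), for any finite number of variables; three are needed for the difference quotient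
of `P`.
-/

noncomputable section

namespace QuasiOrdinary

/-! ### Convergent power series and their values -/

section ConvergentSeries

open MvPowerSeries

variable {κ : Type*} [Fintype κ]

/-- The value of a power series in the variables `κ` at a point, as an unconditional sum. -/
def evalAt (h : MvPowerSeries κ ℂ) (v : κ → ℂ) : ℂ := ∑' d, coeff d h * ∏ i, v i ^ d i

/-- Absolute convergence at the point all of whose coordinates are `r`. -/
def AbsConv (r : ℝ) (h : MvPowerSeries κ ℂ) : Prop :=
  Summable fun d : κ →₀ ℕ => ‖coeff d h‖ * ∏ i, r ^ d i

lemma prod_pow_add {R : Type*} [CommMonoid R] (v : κ → R) (d e : κ →₀ ℕ) :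
    ∏ i, v i ^ (d + e) i = (∏ i, v i ^ d i) * ∏ i, v i ^ e i := by
  simp [pow_add, Finset.prod_mul_distrib]

lemma norm_prod_pow_le {r : ℝ} {v : κ → ℂ} (hv : ∀ i, ‖v i‖ ≤ r) (d : κ →₀ ℕ) :
    ‖∏ i, v i ^ d i‖ ≤ ∏ i, r ^ d i := by
  rw [norm_prod]
  refine Finset.prod_le_prod (fun i _ => norm_nonneg _) fun i _ => ?_
  rw [norm_pow]
  exact pow_le_pow_left₀ (norm_nonneg _) (hv i) _

lemma AbsConv.mono {r r' : ℝ} {h : MvPowerSeries κ ℂ} (H : AbsConv r h) (h0 : 0 ≤ r')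
    (hr : r' ≤ r) : AbsConv r' h := by
  refine Summable.of_nonneg_of_le (fun d => ?_) (fun d => ?_) H
  · exact mul_nonneg (norm_nonneg _) (Finset.prod_nonneg fun i _ => pow_nonneg h0 _)
  · exact mul_le_mul_of_nonneg_left (Finset.prod_le_prod (fun i _ => pow_nonneg h0 _)
      fun i _ => pow_le_pow_left₀ h0 hr _) (norm_nonneg _)

lemma AbsConv.summable_norm {r : ℝ} {h : MvPowerSeries κ ℂ} (H : AbsConv r h) {v : κ → ℂ}
    (hv : ∀ i, ‖v i‖ ≤ r) : Summable fun d => ‖coeff d h * ∏ i, v i ^ d i‖ := by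
  refine Summable.of_nonneg_of_le (fun d => norm_nonneg _) (fun d => ?_) H
  rw [norm_mul]
  exact mul_le_mul_of_nonneg_left (norm_prod_pow_le hv d) (norm_nonneg _)

lemma absConv_iff {r : ℝ} (hr : 0 ≤ r) {h : MvPowerSeries κ ℂ} :
    AbsConv r h ↔ Summable fun d => ‖coeff d h * ∏ i, (r : ℂ) ^ d i‖ := by
  unfold AbsConv
  simp [abs_of_nonneg hr]

lemma coeff_mul_mul_prod_pow [DecidableEq κ] (g h : MvPowerSeries κ ℂ) (v : κ → ℂ) (d : κ →₀ ℕ) :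
    coeff d (g * h) * ∏ i, v i ^ d i = ∑ p ∈ Finset.HasAntidiagonal.antidiagonal d,
      (coeff p.1 g * ∏ i, v i ^ p.1 i) * (coeff p.2 h * ∏ i, v i ^ p.2 i) := by
  classical
  rw [coeff_mul, Finset.sum_mul]
  refine Finset.sum_congr rfl fun p hp => ?_
  rw [← Finset.HasAntidiagonal.mem_antidiagonal.1 hp, prod_pow_add]
  ring

lemma absConv_of_finite {r : ℝ} {h : MvPowerSeries κ ℂ} (s : Finset (κ →₀ ℕ))
    (hs : ∀ d ∉ s, coeff d h = 0) : AbsConv r h :=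
  summable_of_ne_finset_zero (s := s) fun d hd => by simp [hs d hd]

lemma absConv_C (r : ℝ) (c : ℂ) : AbsConv r (C c : MvPowerSeries κ ℂ) := by
  classical
  refine absConv_of_finite {0} fun d hd => ?_
  rw [coeff_C, if_neg (by simpa using hd)]

lemma absConv_X (r : ℝ) (i : κ) : AbsConv r (X i : MvPowerSeries κ ℂ) := by
  classical
  refine absConv_of_finite {Finsupp.single i 1} fun d hd => ?_
  rw [coeff_X, if_neg (by simpa using hd)]

lemma AbsConv.mul {r : ℝ} (hr : 0 ≤ r) {g h : MvPowerSeries κ ℂ} (hg : AbsConv r g)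
    (hh : AbsConv r h) : AbsConv r (g * h) := by
  classical
  rw [absConv_iff hr] at *
  simp_rw [coeff_mul_mul_prod_pow g h (fun _ => (r : ℂ))]
  have h2 := summable_sum_mul_antidiagonal_of_summable_mul
      (Summable.mul_of_nonneg hg hh (fun _ => norm_nonneg _) fun _ => norm_nonneg _)
  refine h2.of_nonneg_of_le (fun _ => norm_nonneg _) fun n => ?_
  refine (norm_sum_le _ _).trans (Finset.sum_le_sum fun p _ => ?_)
  rw [norm_mul]

lemma AbsConv.add {r : ℝ} (hr : 0 ≤ r) {g h : MvPowerSeries κ ℂ} (hg : AbsConv r g)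
    (hh : AbsConv r h) : AbsConv r (g + h) := by
  refine Summable.of_nonneg_of_le (fun d => ?_) (fun d => ?_) (Summable.add hg hh)
  · exact mul_nonneg (norm_nonneg _) (Finset.prod_nonneg fun i _ => pow_nonneg hr _)
  · rw [map_add, ← add_mul]
    exact mul_le_mul_of_nonneg_right (norm_add_le _ _)
      (Finset.prod_nonneg fun i _ => pow_nonneg hr _)

lemma AbsConv.neg {r : ℝ} {g : MvPowerSeries κ ℂ} (hg : AbsConv r g) : AbsConv r (-g) := by
  unfold AbsConv at *
  simpa using hg

/-- The ring of power series converging absolutely on the closed polydisc of radius `r`. -/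
def absConvSubring (κ : Type*) [Fintype κ] {r : ℝ} (hr : 0 ≤ r) :
    Subring (MvPowerSeries κ ℂ) where
  carrier := {h | AbsConv r h}
  mul_mem' := AbsConv.mul hr
  add_mem' := AbsConv.add hr
  neg_mem' := AbsConv.neg
  zero_mem' := by simpa using absConv_C r (0 : ℂ)
  one_mem' := by simpa using absConv_C r (1 : ℂ)

lemma evalAt_C (c : ℂ) (v : κ → ℂ) : evalAt (C c) v = c := by
  classical
  unfold evalAt
  rw [tsum_eq_single 0]
  · simp
  · intro d hd
    rw [coeff_C, if_neg hd, zero_mul]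

lemma evalAt_X (i : κ) (v : κ → ℂ) : evalAt (X i) v = v i := by
  classical
  unfold evalAt
  rw [tsum_eq_single (Finsupp.single i 1)]
  · rw [coeff_X, if_pos rfl, one_mul, Finset.prod_eq_single i]
    · simp
    · intro j _ hj
      simp [hj.symm]
    · simp
  · intro d hd
    rw [coeff_X, if_neg hd, zero_mul]

lemma AbsConv.evalAt_mul {r : ℝ} {g h : MvPowerSeries κ ℂ} (hg : AbsConv r g)
    (hh : AbsConv r h) {v : κ → ℂ} (hv : ∀ i, ‖v i‖ ≤ r) :
    evalAt (g * h) v = evalAt g v * evalAt h v := by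
  classical
  have h1 := hg.summable_norm hv
  have h2 := hh.summable_norm hv
  have h3 := summable_mul_of_summable_norm h1 h2
  have h4 := h1.of_norm.tsum_mul_tsum_eq_tsum_sum_antidiagonal h2.of_norm h3
  unfold evalAt
  rw [h4]
  exact tsum_congr fun d => coeff_mul_mul_prod_pow g h v d

lemma AbsConv.evalAt_add {r : ℝ} {g h : MvPowerSeries κ ℂ} (hg : AbsConv r g)
    (hh : AbsConv r h) {v : κ → ℂ} (hv : ∀ i, ‖v i‖ ≤ r) :
    evalAt (g + h) v = evalAt g v + evalAt h v := by
  unfold evalAt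
  rw [← (hg.summable_norm hv).of_norm.tsum_add (hh.summable_norm hv).of_norm]
  simp [add_mul]

/-- Evaluation at a point of the closed polydisc of radius `r`, as a ring homomorphism. -/
def evalHom {r : ℝ} (hr : 0 ≤ r) {v : κ → ℂ} (hv : ∀ i, ‖v i‖ ≤ r) :
    absConvSubring κ hr →+* ℂ where
  toFun h := evalAt h.1 v
  map_one' := by simpa using evalAt_C (1 : ℂ) v
  map_zero' := by simpa using evalAt_C (0 : ℂ) v
  map_mul' g h := g.2.evalAt_mul h.2 hv
  map_add' g h := g.2.evalAt_add h.2 hv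

lemma evalAt_rescale (a : κ → ℂ) (h : MvPowerSeries κ ℂ) (v : κ → ℂ) :
    evalAt (rescale a h) v = evalAt h (a * v) := by
  unfold evalAt
  refine tsum_congr fun d => ?_
  rw [coeff_rescale, Finsupp.prod_fintype _ _ (by simp)]
  simp only [Pi.mul_apply, mul_pow, Finset.prod_mul_distrib]
  ring

lemma AbsConv.rescale {r : ℝ} (hr : 0 ≤ r) {h : MvPowerSeries κ ℂ} (H : AbsConv r h) {a : κ → ℂ}
    (ha : ∀ i, ‖a i‖ ≤ 1) : AbsConv r (rescale a h) := by
  refine Summable.of_nonneg_of_le (fun d => ?_) (fun d => ?_) H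
  · exact mul_nonneg (norm_nonneg _) (Finset.prod_nonneg fun i _ => pow_nonneg hr _)
  · refine mul_le_mul_of_nonneg_right ?_ (Finset.prod_nonneg fun i _ => pow_nonneg hr _)
    rw [coeff_rescale, Finsupp.prod_fintype _ _ (by simp), norm_mul]
    have := norm_prod_pow_le ha d
    simp only [one_pow, Finset.prod_const_one] at this
    exact mul_le_of_le_one_left (norm_nonneg _) this

/-- Divisibility by a variable does not affect convergence. -/
lemma AbsConv.of_X_mul {r : ℝ} (hr : 0 < r) {h : MvPowerSeries κ ℂ} {i : κ}
    (H : AbsConv r (X i * h)) : AbsConv r h := by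
  classical
  have h1 := H.comp_injective (add_right_injective (Finsupp.single i 1 : κ →₀ ℕ))
  have h2 := h1.mul_left r⁻¹
  refine h2.congr fun d => ?_
  have : ∏ j, r ^ (Finsupp.single i 1 + d : κ →₀ ℕ) j = r * ∏ j, r ^ d j := by
    rw [prod_pow_add (fun _ => r), Finset.prod_eq_single i]
    · simp
    · intro j _ hj
      simp [hj.symm]
    · simp
  simp only [Function.comp]
  rw [X, coeff_add_monomial_mul, this, one_mul]
  field_simp

end ConvergentSeries

/-! ### Convergent power series and analytic germs -/

section AnalyticBridge

open MvPowerSeries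

variable {κ : Type*} [Fintype κ]

/-- Each monomial of degree `n` is the diagonal of an `n`-linear form of norm at most one. -/
lemma exists_multilinear_monomial (d : κ →₀ ℕ) (n : ℕ) (hd : ∑ i, d i = n) :
    ∃ M : ContinuousMultilinearMap ℂ (fun _ : Fin n => κ → ℂ) ℂ,
      ‖M‖ ≤ 1 ∧ ∀ v : κ → ℂ, (M fun _ => v) = ∏ i, v i ^ d i := by
  classical
  set l := (Finsupp.toMultiset d).toList with hl
  have hlen : l.length = n := by
    rw [hl, Multiset.length_toList, Finsupp.card_toMultiset, ← hd,
      Finsupp.sum_fintype _ _ (by simp)]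
    rfl
  subst hlen
  refine ⟨(ContinuousMultilinearMap.mkPiAlgebraFin ℂ l.length ℂ).compContinuousLinearMap
    fun k => ContinuousLinearMap.proj (l.get k), ?_, fun v => ?_⟩
  · refine (ContinuousMultilinearMap.norm_compContinuousLinearMap_le _ _).trans ?_
    rw [ContinuousMultilinearMap.norm_mkPiAlgebraFin, one_mul]
    refine Finset.prod_le_one (fun _ _ => norm_nonneg _) fun k _ => ?_
    refine ContinuousLinearMap.opNorm_le_bound _ zero_le_one fun v => ?_
    rw [one_mul]
    exact norm_le_pi_norm v _
  · rw [ContinuousMultilinearMap.compContinuousLinearMap_apply,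
      ContinuousMultilinearMap.mkPiAlgebraFin_apply]
    have h1 : (List.ofFn fun k : Fin l.length => v (l.get k)) = l.map v := by
      refine List.ext_get (by simp) fun k h1 h2 => by simp
    have h2 : (l.map v).prod = ∏ i, v i ^ d i := by
      have : (l.map v).prod = ((Finsupp.toMultiset d).map v).prod := by
        conv_rhs => rw [← Multiset.coe_toList (Finsupp.toMultiset d)]
        simp [hl]
      rw [this, Finsupp.toMultiset_map, Finsupp.prod_toMultiset,
        Finsupp.prod_mapDomain_index (by simp) (by intros; rw [pow_add]),
        Finsupp.prod_fintype _ _ (by simp)]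
    simpa [h1] using h2

/-- The monomial `d` as a multilinear form of degree `n` (zero unless `d` has degree `n`). -/
def monomialForm (n : ℕ) (d : κ →₀ ℕ) : ContinuousMultilinearMap ℂ (fun _ : Fin n => κ → ℂ) ℂ :=
  open Classical in
  if hd : ∑ i, d i = n then (exists_multilinear_monomial d n hd).choose else 0

open Classical in
/-- The formal multilinear series whose terms are the homogeneous parts of a power series. -/
def toFormalMultilinear (h : MvPowerSeries κ ℂ) : FormalMultilinearSeries ℂ (κ → ℂ) ℂ :=
  fun n => ∑ d ∈ Finset.finsuppAntidiag Finset.univ n, coeff d h • monomialForm n d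

lemma norm_monomialForm_le (n : ℕ) (d : κ →₀ ℕ) : ‖monomialForm n d‖ ≤ 1 := by
  unfold monomialForm
  split_ifs with hd
  · exact (exists_multilinear_monomial d n hd).choose_spec.1
  · simp

open Classical in
lemma mem_finsuppAntidiag_univ {n : ℕ} {d : κ →₀ ℕ} :
    d ∈ Finset.finsuppAntidiag Finset.univ n ↔ ∑ i, d i = n := by
  simp [Finset.mem_finsuppAntidiag]

open Classical in
lemma toFormalMultilinear_apply (h : MvPowerSeries κ ℂ) (n : ℕ) (v : κ → ℂ) :
    (toFormalMultilinear h n fun _ => v) =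
      ∑ d ∈ Finset.finsuppAntidiag Finset.univ n, coeff d h * ∏ i, v i ^ d i := by
  unfold toFormalMultilinear
  rw [sum_apply]
  refine Finset.sum_congr rfl fun d hd => ?_
  have hd' := mem_finsuppAntidiag_univ.1 hd
  rw [smul_apply, smul_eq_mul, monomialForm, dif_pos hd',
    (exists_multilinear_monomial d n hd').choose_spec.2]

open Classical in
/-- Summation of a family indexed by exponents, degree by degree. -/
lemma hasSum_degree {E : Type*} [NormedAddCommGroup E] [CompleteSpace E]
    {a : (κ →₀ ℕ) → E} (ha : Summable fun d => a d) :
    HasSum (fun n => ∑ d ∈ Finset.finsuppAntidiag Finset.univ n, a d) (∑' d, a d) := by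
  have h1 := (Equiv.sigmaFiberEquiv fun d : κ →₀ ℕ => ∑ i, d i).hasSum_iff.mpr ha.hasSum
  refine h1.sigma fun n => ?_
  have h2 := Finset.hasSum (Finset.finsuppAntidiag (Finset.univ : Finset κ) n) a
  exact (Equiv.subtypeEquivRight (p := fun d : κ →₀ ℕ => ∑ i, d i = n)
    (q := fun d => d ∈ Finset.finsuppAntidiag (Finset.univ : Finset κ) n)
    fun d => mem_finsuppAntidiag_univ.symm).hasSum_iff.mpr h2

lemma AbsConv.hasFPowerSeriesOnBall {r : ℝ} (hr : 0 < r) {h : MvPowerSeries κ ℂ}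
    (H : AbsConv r h) :
    HasFPowerSeriesOnBall (evalAt h) (toFormalMultilinear h) 0 (ENNReal.ofReal r) := by
  classical
  refine ⟨?_, by simpa using hr, fun {y} hy => ?_⟩
  · refine FormalMultilinearSeries.le_radius_of_summable_norm (r := r.toNNReal) _ ?_
    have h1 := (hasSum_degree H).summable
    refine h1.of_nonneg_of_le (fun n => by positivity) fun n => ?_
    rw [Real.coe_toNNReal r hr.le]
    have h2 : ‖toFormalMultilinear h n‖ ≤
        ∑ d ∈ Finset.finsuppAntidiag Finset.univ n, ‖coeff d h‖ := by
      refine (norm_sum_le _ _).trans (Finset.sum_le_sum fun d _ => ?_)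
      rw [norm_smul]
      exact mul_le_of_le_one_right (norm_nonneg _) (norm_monomialForm_le n d)
    refine (mul_le_mul_of_nonneg_right h2 (by positivity)).trans ?_
    rw [Finset.sum_mul]
    refine Finset.sum_le_sum fun d hd => ?_
    rw [Finset.prod_pow_eq_pow_sum, mem_finsuppAntidiag_univ.1 hd]
  · have hy' : ∀ i, ‖y i‖ ≤ r := fun i => by
      have : ‖y‖ < r := by
        simpa [Metric.eball_ofReal] using hy
      exact (norm_le_pi_norm y i).trans this.le
    have h1 := hasSum_degree (H.summable_norm hy').of_norm
    simp_rw [toFormalMultilinear_apply]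
    simpa [evalAt] using h1

lemma AbsConv.analyticAt {r : ℝ} (hr : 0 < r) {h : MvPowerSeries κ ℂ} (H : AbsConv r h) :
    AnalyticAt ℂ (evalAt h) 0 :=
  (H.hasFPowerSeriesOnBall hr).analyticAt

/-- A convergent power series is determined by its germ at the origin. -/
lemma AbsConv.eq_zero {r : ℝ} (hr : 0 < r) {h : MvPowerSeries κ ℂ} (H : AbsConv r h)
    (h0 : ∀ᶠ v in 𝓝 (0 : κ → ℂ), evalAt h v = 0) : h = 0 := by
  classical
  have h1 : HasFPowerSeriesAt (0 : (κ → ℂ) → ℂ) (toFormalMultilinear h) 0 :=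
    (H.hasFPowerSeriesOnBall hr).hasFPowerSeriesAt.congr h0
  ext d
  rw [map_zero]
  set n := ∑ i, d i
  let q : MvPolynomial κ ℂ :=
    ∑ d ∈ Finset.finsuppAntidiag Finset.univ n, MvPolynomial.monomial d (coeff d h)
  have hq : q = 0 := by
    refine MvPolynomial.funext fun v => ?_
    have := h1.apply_eq_zero n v
    rw [toFormalMultilinear_apply] at this
    rw [map_zero, ← this, map_sum]
    refine Finset.sum_congr rfl fun d _ => ?_
    rw [MvPolynomial.eval_monomial, Finsupp.prod_fintype _ _ (by simp)]
  have h2 := congrArg (MvPolynomial.coeff d) hq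
  rw [MvPolynomial.coeff_sum, MvPolynomial.coeff_zero, Finset.sum_eq_single d] at h2
  · simpa using h2
  · intro e _ hed
    rw [MvPolynomial.coeff_monomial, if_neg hed]
  · intro hd
    exact absurd (mem_finsuppAntidiag_univ.2 rfl) hd

/-- The exponent of the monomial `∏ k, v (w k)`. -/
def wordCount {n : ℕ} (w : Fin n → κ) : κ →₀ ℕ := ∑ k, Finsupp.single (w k) 1

lemma prod_word {R : Type*} [CommMonoid R] {n : ℕ} (w : Fin n → κ) (v : κ → R) :
    ∏ k, v (w k) = ∏ i, v i ^ wordCount w i := by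
  classical
  have : ∀ i, v i ^ wordCount w i = ∏ k, if w k = i then v i else 1 := fun i => by
    rw [wordCount, Finsupp.finsetSum_apply, ← Finset.prod_pow_eq_pow_sum]
    refine Finset.prod_congr rfl fun k _ => ?_
    by_cases hk : w k = i <;> simp [hk]
  simp_rw [this]
  rw [Finset.prod_comm]
  simp

/-- Every analytic germ at the origin is the germ of a convergent power series: group the words in
the multilinear expansion by the monomial they represent. -/
lemma exists_absConv_of_analyticAt {F : (κ → ℂ) → ℂ} (hF : AnalyticAt ℂ F 0) :
    ∃ r > 0, ∃ h : MvPowerSeries κ ℂ, AbsConv r h ∧ F =ᶠ[𝓝 0] evalAt h := by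
  classical
  obtain ⟨p, ρ, hp⟩ := hF
  obtain ⟨C, R, hC, hR, hpn⟩ := p.le_mul_pow_of_radius_pos (hp.r_pos.trans_le hp.r_le)
  -- The coefficient belonging to a word in the basis vectors.
  let b : (Σ n, Fin n → κ) → ℂ := fun w => p w.1 fun k => (Pi.single (w.2 k) 1 : κ → ℂ)
  have hb : ∀ w, ‖b w‖ ≤ C * R ^ w.1 := fun w => by
    refine ((p w.1).le_opNorm _).trans ?_
    refine (mul_le_of_le_one_right (norm_nonneg _) ?_).trans (hpn _)
    exact Finset.prod_le_one (fun _ _ => norm_nonneg _) fun k _ => by rw [Pi.norm_single, norm_one]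
  -- There are `K ^ n` words of length `n`, so a radius `r < 1 / (K R)` is good enough.
  set K : ℝ := (Fintype.card κ : ℝ) with hK
  have hK0 : 0 ≤ K := Nat.cast_nonneg _
  obtain ⟨r, hr, hr1⟩ : ∃ r > 0, K * R * r < 1 := by
    refine ⟨(K * R + 1)⁻¹, by positivity, ?_⟩
    rw [← div_eq_mul_inv, div_lt_one (by positivity)]
    linarith
  have hS : Summable fun w : Σ n, Fin n → κ => ‖b w‖ * r ^ w.1 := by
    rw [summable_sigma_of_nonneg fun w => by positivity]
    refine ⟨fun n => Summable.of_finite, ?_⟩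
    have hg := (summable_geometric_of_lt_one (by positivity) hr1).mul_left C
    refine hg.of_nonneg_of_le (fun n => tsum_nonneg fun w => by positivity) fun n => ?_
    rw [tsum_fintype]
    refine (Finset.sum_le_card_nsmul _ _ (C * R ^ n * r ^ n) fun w _ => ?_).trans ?_
    · exact mul_le_mul_of_nonneg_right (hb ⟨n, w⟩) (by positivity)
    · rw [Finset.card_univ, Fintype.card_fun, Fintype.card_fin, nsmul_eq_mul, Nat.cast_pow, ← hK]
      exact le_of_eq (by ring)
  let cnt : (Σ n, Fin n → κ) → (κ →₀ ℕ) := fun w => wordCount w.2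
  have hprod : ∀ (w : Σ n, Fin n → κ), r ^ w.1 = ∏ i, r ^ cnt w i := fun w => by
    rw [← prod_word w.2 (fun _ => r)]
    simp
  let h : MvPowerSeries κ ℂ := fun d => ∑' w : {w // cnt w = d}, b w
  have hcoeff : ∀ d, coeff d h = ∑' w : {w // cnt w = d}, b w := fun d => rfl
  have hS' := (Equiv.sigmaFiberEquiv cnt).summable_iff.mpr hS
  have hconv : AbsConv r h := by
    have h1 := (summable_sigma_of_nonneg (fun w => by
      simp only [Function.comp]; positivity)).1 hS'
    refine h1.2.of_nonneg_of_le (fun d => by positivity) fun d => ?_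
    have h2 : Summable fun w : {w // cnt w = d} => ‖b w‖ := by
      refine ((h1.1 d).mul_right ((∏ i, r ^ d i)⁻¹)).congr fun w => ?_
      have : (∏ i, r ^ d i) ≠ 0 := by positivity
      simp only [Function.comp, Equiv.sigmaFiberEquiv, Equiv.coe_fn_mk]
      rw [hprod, w.2]
      field_simp
    rw [hcoeff]
    refine (mul_le_mul_of_nonneg_right (norm_tsum_le_tsum_norm h2) (by positivity)).trans ?_
    rw [← tsum_mul_right]
    refine le_of_eq (tsum_congr fun w => ?_)
    simp only [Function.comp, Equiv.sigmaFiberEquiv, Equiv.coe_fn_mk]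
    rw [hprod, w.2]
  refine ⟨r, hr, h, hconv, ?_⟩
  have hball : ∀ᶠ v in 𝓝 (0 : κ → ℂ), v ∈ Metric.eball (0 : κ → ℂ) ρ :=
    Metric.eball_mem_nhds _ hp.r_pos
  have hball' : ∀ᶠ v in 𝓝 (0 : κ → ℂ), v ∈ Metric.ball (0 : κ → ℂ) r := Metric.ball_mem_nhds _ hr
  filter_upwards [hball, hball'] with v hv hv'
  have hvr : ∀ i, ‖v i‖ ≤ r := fun i =>
    (norm_le_pi_norm v i).trans (mem_ball_zero_iff.1 hv').le
  let a : (Σ n, Fin n → κ) → ℂ := fun w => b w * ∏ k, v (w.2 k)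
  have ha : Summable a := by
    refine Summable.of_norm (hS.of_nonneg_of_le (fun _ => norm_nonneg _) fun w => ?_)
    rw [norm_mul, norm_prod]
    refine mul_le_mul_of_nonneg_left ?_ (norm_nonneg _)
    exact (Finset.prod_le_prod (fun _ _ => norm_nonneg _) fun k _ => hvr (w.2 k)).trans (by simp)
  have hdiag : ∀ n, (p n fun _ => v) = ∑ w : Fin n → κ, a ⟨n, w⟩ := fun n => by
    -- Expand `v` in the basis vectors.
    have hv1 : v = ∑ i, v i • (Pi.single i 1 : κ → ℂ) := by
      ext j
      simp [Finset.sum_apply, Pi.single_apply]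
    have h2 := (p n).map_sum (fun (_ : Fin n) (i : κ) => v i • (Pi.single i 1 : κ → ℂ))
    rw [← hv1] at h2
    rw [h2]
    refine Finset.sum_congr rfl fun w _ => ?_
    rw [(p n).map_smul_univ (fun k => v (w k))]
    simp [a, b, mul_comm]
  have h1 : HasSum (fun n => p n fun _ => v) (∑' w, a w) := by
    simp_rw [hdiag]
    exact ha.hasSum.sigma fun n => hasSum_fintype _
  have h2 := hp.hasSum hv
  rw [zero_add] at h2
  rw [h2.unique h1]
  have h3 := (Equiv.sigmaFiberEquiv cnt).hasSum_iff.mpr ha.hasSum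
  have h4 := h3.summable.tsum_sigma
  rw [h3.tsum_eq] at h4
  rw [h4]
  refine tsum_congr fun d => ?_
  rw [hcoeff, ← tsum_mul_right]
  refine tsum_congr fun w => ?_
  simp only [Function.comp, Equiv.sigmaFiberEquiv, Equiv.coe_fn_mk, a]
  rw [prod_word, show wordCount w.1.2 = d from w.2]

lemma X_dvd_iff_rescale {κ : Type*} [DecidableEq κ] {i : κ} {h : MvPowerSeries κ ℂ} :
    X i ∣ h ↔ rescale (Function.update 1 i 0) h = 0 := by
  rw [X_dvd_iff]
  constructor
  · intro H
    ext d
    rw [coeff_rescale, map_zero]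
    by_cases hd : d i = 0
    · rw [H d hd, mul_zero]
    · rw [Finsupp.prod, Finset.prod_eq_zero (i := i) (by simpa using hd) (by simp [hd]), zero_mul]
  · intro H d hd
    have h1 := congrArg (coeff d) H
    rw [coeff_rescale, map_zero, Finsupp.prod, Finset.prod_eq_one, one_mul] at h1
    · exact h1
    · intro j hj
      have : j ≠ i := by rintro rfl; simp [hd] at hj
      simp [this]

/-- An analytic germ vanishing on a coordinate hyperplane is divisible by that coordinate. -/
lemma exists_eq_coord_mul {F : (κ → ℂ) → ℂ} (hF : AnalyticAt ℂ F 0) (i : κ)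
    (h0 : ∀ᶠ v in 𝓝 (0 : κ → ℂ), v i = 0 → F v = 0) :
    ∃ N : (κ → ℂ) → ℂ, AnalyticAt ℂ N 0 ∧ ∀ᶠ v in 𝓝 (0 : κ → ℂ), F v = v i * N v := by
  classical
  obtain ⟨r, hr, h, hh, hFh⟩ := exists_absConv_of_analyticAt hF
  set a : κ → ℂ := Function.update 1 i 0
  have ha : ∀ j, ‖a j‖ ≤ 1 := fun j => by
    by_cases hj : j = i
    · subst hj; simp [a]
    · simp [a, hj]
  have htend : Tendsto (fun v : κ → ℂ => a * v) (𝓝 0) (𝓝 0) := by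
    have : Continuous fun v : κ → ℂ => a * v := by fun_prop
    simpa using this.tendsto 0
  have hz : rescale a h = 0 := by
    refine (hh.rescale hr.le ha).eq_zero hr ?_
    filter_upwards [htend.eventually h0, htend.eventually hFh] with v h1 h2
    rw [evalAt_rescale, ← h2]
    exact h1 (by simp [a])
  obtain ⟨k, rfl⟩ := X_dvd_iff_rescale.2 hz
  have hk := hh.of_X_mul hr
  refine ⟨evalAt k, hk.analyticAt hr, ?_⟩
  have hball' : ∀ᶠ v in 𝓝 (0 : κ → ℂ), v ∈ Metric.ball (0 : κ → ℂ) r := Metric.ball_mem_nhds _ hr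
  filter_upwards [hFh, hball'] with v hv hv'
  rw [hv, (absConv_X r i).evalAt_mul hk fun i =>
    (norm_le_pi_norm v i).trans (mem_ball_zero_iff.1 hv').le, evalAt_X]

end AnalyticBridge

/-! ### Monomials times units, and discriminants -/

section MonomialTimesUnit

open MvPowerSeries

instance : IsDomain Series := NoZeroDivisors.to_isDomain _

/-- The exponent of the monomial `x ^ u * y ^ v`. -/
def expo (u v : ℕ) : Fin 2 →₀ ℕ := Finsupp.single 0 u + Finsupp.single 1 v

@[simp] lemma expo_zero (u v : ℕ) : expo u v 0 = u := by simp [expo]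

@[simp] lemma expo_one (u v : ℕ) : expo u v 1 = v := by simp [expo]

lemma expo_le_iff {u v : ℕ} {d : Fin 2 →₀ ℕ} : expo u v ≤ d ↔ u ≤ d 0 ∧ v ≤ d 1 := by
  rw [Finsupp.le_def, Fin.forall_fin_two, expo_zero, expo_one]

lemma expo_eta (d : Fin 2 →₀ ℕ) : expo (d 0) (d 1) = d := by
  ext i; fin_cases i <;> simp

lemma X_pow_mul_X_pow (u v : ℕ) : (X 0 ^ u * X 1 ^ v : Series) = monomial (expo u v) 1 := by
  rw [X_pow_eq, X_pow_eq, monomial_mul_monomial, one_mul]; rfl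

/-- A series is `x ^ u * y ^ v` times a unit iff `(u, v)` is the least element of its support. -/
lemma isMonomialTimesUnit_iff {h : Series} {u v : ℕ} : IsMonomialTimesUnit h u v ↔
    coeff (expo u v) h ≠ 0 ∧ ∀ d, coeff d h ≠ 0 → u ≤ d 0 ∧ v ≤ d 1 := by
  classical
  constructor
  · rintro ⟨ε, hε, rfl⟩
    rw [X_pow_mul_X_pow]
    refine ⟨by simpa [coeff_monomial_mul] using hε, fun d hd => ?_⟩
    rw [coeff_monomial_mul] at hd
    by_contra hc
    rw [if_neg (fun h => hc (expo_le_iff.1 h))] at hd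
    exact hd rfl
  · rintro ⟨h1, h2⟩
    let ε : Series := fun d => coeff (expo u v + d) h
    have hε : ∀ d, coeff d ε = coeff (expo u v + d) h := fun d => rfl
    refine ⟨ε, ?_, ?_⟩
    · rw [← coeff_zero_eq_constantCoeff_apply, hε, add_zero]
      exact h1
    · ext d
      rw [X_pow_mul_X_pow, coeff_monomial_mul]
      split_ifs with hd
      · rw [hε, one_mul, add_tsub_cancel_of_le hd]
      · by_contra hc
        exact hd (expo_le_iff.2 (h2 d hc))

lemma IsMonomialTimesUnit.unique {h : Series} {u v u' v' : ℕ} (H : IsMonomialTimesUnit h u v)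
    (H' : IsMonomialTimesUnit h u' v') : u = u' ∧ v = v' := by
  rw [isMonomialTimesUnit_iff] at H H'
  have h1 := H.2 _ H'.1
  have h2 := H'.2 _ H.1
  simp only [expo_zero, expo_one] at h1 h2
  omega

lemma IsMonomialTimesUnit.ne_zero {h : Series} {u v : ℕ} (H : IsMonomialTimesUnit h u v) :
    h ≠ 0 := by
  rintro rfl
  exact (isMonomialTimesUnit_iff.1 H).1 (by simp)

lemma IsMonomialTimesUnit.mul {g h : Series} {u v u' v' : ℕ} (hg : IsMonomialTimesUnit g u v)
    (hh : IsMonomialTimesUnit h u' v') : IsMonomialTimesUnit (g * h) (u + u') (v + v') := by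
  obtain ⟨ε, hε, rfl⟩ := hg
  obtain ⟨δ, hδ, rfl⟩ := hh
  exact ⟨ε * δ, by rw [map_mul]; exact mul_ne_zero hε hδ, by ring⟩

lemma isMonomialTimesUnit_of_unit {g : Series} (hg : constantCoeff g ≠ 0) :
    IsMonomialTimesUnit g 0 0 := ⟨g, hg, by simp⟩

/-- The variables are prime: divisibility by `X i` is the kernel of setting `X i` to zero. -/
lemma X_dvd_or_X_dvd_of_dvd_mul {κ : Type*} {i : κ} {g h : MvPowerSeries κ ℂ}
    (H : X i ∣ g * h) : X i ∣ g ∨ X i ∣ h := by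
  classical
  rw [X_dvd_iff_rescale] at *
  rw [X_dvd_iff_rescale]
  rwa [map_mul, mul_eq_zero] at H

lemma series_X_ne_zero (i : Fin 2) : (X i : Series) ≠ 0 := by
  intro h
  have := congrArg (coeff (Finsupp.single i 1)) h
  simp at this

/-- A divisor of a monomial times a unit is a monomial times a unit. -/
lemma IsMonomialTimesUnit.of_mul {u v : ℕ} : ∀ {g h : Series},
    IsMonomialTimesUnit (g * h) u v → ∃ u' v', IsMonomialTimesUnit g u' v' := by
  have aux : ∀ (i : Fin 2) (g : Series) (u v : ℕ), IsMonomialTimesUnit g u v →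
      ∃ u' v', IsMonomialTimesUnit (X i * g) u' v' := fun i g u v hg => by
    fin_cases i
    · exact ⟨_, _, IsMonomialTimesUnit.mul (u := 1) (v := 0) ⟨1, by simp, by simp⟩ hg⟩
    · exact ⟨_, _, IsMonomialTimesUnit.mul (u := 0) (v := 1) ⟨1, by simp, by simp⟩ hg⟩
  -- One variable at a time is cancelled, from whichever factor it divides.
  have step : ∀ (i : Fin 2) (u v u' v' : ℕ),
      (∀ {g h : Series}, IsMonomialTimesUnit (g * h) u v → ∃ a b, IsMonomialTimesUnit g a b) →
      (∀ ε : Series, (X 0 ^ u' * X 1 ^ v' * ε : Series) = X i * (X 0 ^ u * X 1 ^ v * ε)) →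
      ∀ {g h : Series}, IsMonomialTimesUnit (g * h) u' v' →
        ∃ a b, IsMonomialTimesUnit g a b := by
    rintro i u v u' v' ih heq g h ⟨ε, hε, hgh⟩
    rw [heq] at hgh
    rcases X_dvd_or_X_dvd_of_dvd_mul ⟨_, hgh⟩ with ⟨g', rfl⟩ | ⟨h', rfl⟩
    · rw [mul_assoc] at hgh
      obtain ⟨a, b, hab⟩ := ih ⟨ε, hε, mul_left_cancel₀ (series_X_ne_zero i) hgh⟩
      exact aux i g' a b hab
    · rw [mul_left_comm] at hgh
      exact ih ⟨ε, hε, mul_left_cancel₀ (series_X_ne_zero i) hgh⟩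
  induction u with
  | zero =>
    induction v with
    | zero =>
      rintro g h ⟨ε, hε, hgh⟩
      refine ⟨0, 0, isMonomialTimesUnit_of_unit fun h0 => hε ?_⟩
      have := congrArg constantCoeff hgh
      simpa [h0] using this.symm
    | succ v ih => exact step 1 0 v 0 (v + 1) ih fun ε => by ring
  | succ u ih => exact step 0 u v (u + 1) v ih fun ε => by ring

/-- The series is zero or a monomial times a unit. -/
def ZeroOrMonomial (h : Series) : Prop := h = 0 ∨ ∃ u v, IsMonomialTimesUnit h u v

lemma ZeroOrMonomial.mul {g h : Series} (hg : ZeroOrMonomial g) (hh : ZeroOrMonomial h) :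
    ZeroOrMonomial (g * h) := by
  rcases hg with rfl | ⟨u, v, hg⟩
  · exact Or.inl (zero_mul _)
  rcases hh with rfl | ⟨u', v', hh⟩
  · exact Or.inl (mul_zero _)
  exact Or.inr ⟨_, _, hg.mul hh⟩

lemma IsMonomialTimesUnit.congr_support {g h : Series} {u v : ℕ} (H : IsMonomialTimesUnit g u v)
    (hs : ∀ d, coeff d h ≠ 0 ↔ coeff d g ≠ 0) : IsMonomialTimesUnit h u v := by
  rw [isMonomialTimesUnit_iff] at *
  exact ⟨(hs _).2 H.1, fun d hd => H.2 d ((hs d).1 hd)⟩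

lemma coeff_rescale_ne_zero {a : Fin 2 → ℂ} (ha : ∀ i, a i ≠ 0) (h : Series) (d : Fin 2 →₀ ℕ) :
    coeff d (rescale a h) ≠ 0 ↔ coeff d h ≠ 0 := by
  rw [coeff_rescale, Finsupp.prod_fintype _ _ (by simp)]
  have : ∏ i, a i ^ d i ≠ 0 := Finset.prod_ne_zero_iff.2 fun i _ => pow_ne_zero _ (ha i)
  rw [Ne, mul_eq_zero, or_iff_right this]

lemma isMonomialTimesUnit_rescale_iff {a : Fin 2 → ℂ} (ha : ∀ i, a i ≠ 0) {h : Series} {u v : ℕ} :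
    IsMonomialTimesUnit (rescale a h) u v ↔ IsMonomialTimesUnit h u v :=
  ⟨fun H => H.congr_support fun d => (coeff_rescale_ne_zero ha h d).symm,
    fun H => H.congr_support fun d => coeff_rescale_ne_zero ha h d⟩

lemma ZeroOrMonomial.rescale {a : Fin 2 → ℂ} (ha : ∀ i, a i ≠ 0) {h : Series}
    (H : ZeroOrMonomial h) : ZeroOrMonomial (rescale a h) := by
  rcases H with rfl | ⟨u, v, H⟩
  · exact Or.inl (map_zero _)
  · exact Or.inr ⟨u, v, (isMonomialTimesUnit_rescale_iff ha).2 H⟩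

lemma IsMonomialTimesUnit.of_expand {n : ℕ} (hn : n ≠ 0) {h : Series} {u v : ℕ}
    (H : IsMonomialTimesUnit (expand n hn h) u v) : ∃ a b, IsMonomialTimesUnit h a b := by
  rw [isMonomialTimesUnit_iff] at H
  have hdvd : ∀ i, n ∣ expo u v i := fun i => by
    by_contra hc
    exact H.1 (coeff_expand_of_not_dvd n hn h hc)
  obtain ⟨a, rfl⟩ : n ∣ u := by simpa using hdvd 0
  obtain ⟨b, rfl⟩ : n ∣ v := by simpa using hdvd 1
  have he : expo (n * a) (n * b) = n • expo a b := by
    ext i; fin_cases i <;> simp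
  refine ⟨a, b, isMonomialTimesUnit_iff.2 ⟨?_, fun d hd => ?_⟩⟩
  · rw [← coeff_expand_smul n hn, ← he]
    exact H.1
  · have := H.2 (n • d) (by rwa [coeff_expand_smul])
    simpa [Nat.mul_le_mul_left_iff (Nat.pos_of_ne_zero hn)] using this

/-- If two series and their difference are monomials times units, the two exponents are
comparable: the exponent of the difference would have to lie below both, while it lies in the
support of one of them. -/
lemma IsMonomialTimesUnit.comparable {g h : Series} {u v u' v' : ℕ}
    (hg : IsMonomialTimesUnit g u v) (hh : IsMonomialTimesUnit h u' v')
    (hd : ZeroOrMonomial (g - h)) : (u ≤ u' ∧ v ≤ v') ∨ (u' ≤ u ∧ v' ≤ v) := by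
  rcases hd with h0 | ⟨p, q, hpq⟩
  · rw [sub_eq_zero] at h0
    subst h0
    obtain ⟨rfl, rfl⟩ := hg.unique hh
    exact Or.inl ⟨le_rfl, le_rfl⟩
  rw [isMonomialTimesUnit_iff] at hg hh hpq
  by_contra! hc
  have h1 : coeff (expo u v) h = 0 := by
    by_contra h1
    have := hh.2 _ h1
    simp only [expo_zero, expo_one] at this
    omega
  have h2 : coeff (expo u' v') g = 0 := by
    by_contra h2
    have := hg.2 _ h2
    simp only [expo_zero, expo_one] at this
    omega
  have h3 := hpq.2 (expo u v) (by rw [map_sub, h1, sub_zero]; exact hg.1)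
  have h4 := hpq.2 (expo u' v') (by rw [map_sub, h2, zero_sub]; exact neg_ne_zero.2 hh.1)
  simp only [expo_zero, expo_one] at h3 h4
  by_cases h5 : coeff (expo p q) g = 0
  · have h6 := hh.2 (expo p q) fun h6 => hpq.1 (by rw [map_sub, h5, h6, sub_zero])
    simp only [expo_zero, expo_one] at h6
    omega
  · have h6 := hg.2 _ h5
    simp only [expo_zero, expo_one] at h6
    omega

end MonomialTimesUnit

section Discriminant

open Polynomial

lemma discr_eq_resultant {R : Type*} [CommRing R] {f : R[X]} (hf : f.Monic)
    (hd : 0 < f.natDegree) :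
    f.discr = (-1) ^ (f.natDegree * (f.natDegree - 1) / 2) *
      f.resultant f.derivative f.natDegree (f.natDegree - 1) := by
  rw [resultant_deriv (natDegree_pos_iff_degree_pos.1 hd), hf.leadingCoeff, mul_one, ← mul_assoc,
    ← mul_pow]
  simp

lemma map_discr {R S : Type*} [CommRing R] [CommRing S] [Nontrivial S] (φ : R →+* S) {f : R[X]}
    (hf : f.Monic) (hd : 0 < f.natDegree) : φ f.discr = (f.map φ).discr := by
  have h1 : (f.map φ).natDegree = f.natDegree := hf.natDegree_map φ
  rw [discr_eq_resultant hf hd, discr_eq_resultant (hf.map φ) (by rwa [h1]), h1, derivative_map,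
    resultant_map_map]
  simp

/-- The discriminant of `∏ (X - h)` is, up to sign, the product of the differences of the roots. -/
lemma discr_prod_X_sub_C {R : Type*} [CommRing R] [IsDomain R] [DecidableEq R] {s : Finset R}
    (hs : s.Nonempty) : ∃ k : ℕ, (∏ h ∈ s, (X - C h)).discr =
      (-1) ^ k * ∏ h ∈ s, ∏ h' ∈ s.erase h, (h - h') := by
  have hm : (∏ h ∈ s, (X - C h)).Monic := monic_prod_of_monic _ _ fun h _ => monic_X_sub_C h
  have hdeg : (∏ h ∈ s, (X - C h)).natDegree = s.card := by
    rw [natDegree_prod_of_monic _ _ fun h _ => monic_X_sub_C h]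
    simp
  refine ⟨(∏ h ∈ s, (X - C h)).natDegree * ((∏ h ∈ s, (X - C h)).natDegree - 1) / 2, ?_⟩
  rw [discr_eq_resultant hm (by rw [hdeg]; exact hs.card_pos)]
  congr 1
  rw [resultant_prod_left _ _ _ _ (by simp) (natDegree_derivative_le _)]
  refine Finset.prod_congr rfl fun h hh => ?_
  rw [natDegree_X_sub_C, resultant_X_sub_C_left _ _ _ (natDegree_derivative_le _),
    ← Finset.mul_prod_erase s _ hh, derivative_mul]
  simp [eval_prod]

end Discriminant

/-! ### Recognizing parametrizations -/

section Characterization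

open MvPowerSeries

lemma convergent_iff {h : Series} : Convergent h ↔ ∃ r > 0, AbsConv r h := by
  simp only [Convergent, AbsConv, Fin.prod_univ_two, pow_add, gt_iff_lt]

lemma value_eq_evalAt (h : Series) (x y : ℂ) : value h x y = evalAt h ![x, y] := by
  simp [value, evalAt, Fin.prod_univ_two, mul_assoc]

section Expand

variable {n : ℕ}

lemma nsmul_injective_of_ne_zero (hn : n ≠ 0) : Function.Injective fun d : Fin 2 →₀ ℕ => n • d :=
  nsmul_right_injective hn

lemma coeff_expand_of_not_mem_range (hn : n ≠ 0) (g : Series) {d : Fin 2 →₀ ℕ}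
    (hd : d ∉ Set.range fun d : Fin 2 →₀ ℕ => n • d) : coeff d (expand n hn g) = 0 := by
  by_contra hc
  have hdvd : ∀ i, n ∣ d i := fun i => by
    by_contra h
    exact hc (coeff_expand_of_not_dvd n hn g h)
  choose e he using hdvd
  exact hd ⟨Finsupp.equivFunOnFinite.symm e, by ext i; simp [he]⟩

lemma evalAt_expand (hn : n ≠ 0) (g : Series) (v : Fin 2 → ℂ) :
    evalAt (expand n hn g) v = evalAt g (v ^ n) := by
  unfold evalAt
  rw [← (nsmul_injective_of_ne_zero hn).tsum_eq]
  · refine tsum_congr fun d => ?_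
    simp only [coeff_expand_smul]
    simp [pow_mul]
  · intro d hd
    by_contra hc
    exact hd (by simp only [coeff_expand_of_not_mem_range hn g hc, zero_mul])

lemma absConv_expand_iff (hn : n ≠ 0) {r : ℝ} {g : Series} :
    AbsConv r (expand n hn g) ↔ AbsConv (r ^ n) g := by
  unfold AbsConv
  rw [← (nsmul_injective_of_ne_zero hn).summable_iff]
  · refine summable_congr fun d => ?_
    simp only [Function.comp, coeff_expand_smul]
    simp [pow_mul]
  · intro d hd
    simp only [coeff_expand_of_not_mem_range hn g hd, norm_zero, zero_mul]

lemma convergent_expand_iff (hn : n ≠ 0) {g : Series} :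
    Convergent (expand n hn g) ↔ Convergent g := by
  simp only [convergent_iff]
  constructor
  · rintro ⟨r, hr, h⟩
    exact ⟨r ^ n, pow_pos hr n, (absConv_expand_iff hn).1 h⟩
  · rintro ⟨r, hr, h⟩
    refine ⟨r ^ (1 / n : ℝ), Real.rpow_pos_of_pos hr _, (absConv_expand_iff hn).2 ?_⟩
    rw [← Real.rpow_natCast, ← Real.rpow_mul hr.le, one_div_mul_cancel (by exact_mod_cast hn),
      Real.rpow_one]
    exact h

lemma rescale_expand (hn : n ≠ 0) {ω : Fin 2 → ℂ} (hω : ∀ i, ω i ^ n = 1) (g : Series) :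
    rescale ω (expand n hn g) = expand n hn g := by
  ext d
  by_cases hd : d ∈ Set.range fun d : Fin 2 →₀ ℕ => n • d
  · obtain ⟨e, rfl⟩ := hd
    rw [coeff_rescale, Finsupp.prod_fintype _ _ (by simp)]
    simp [pow_mul, hω]
  · rw [coeff_rescale, coeff_expand_of_not_mem_range hn g hd, mul_zero]

/-- A term which is not a monomial in the `n`-th powers of the variables is changed by multiplying
the variables with suitable `n`-th roots of unity. -/
lemma exists_coeff_rescale_sub_ne_zero (hn : n ≠ 0) {g : Series} {d : Fin 2 →₀ ℕ}
    (hd : d ∉ Set.range fun d : Fin 2 →₀ ℕ => n • d) (hc : coeff d g ≠ 0) :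
    ∃ ω : Fin 2 → ℂ, (∀ i, ω i ^ n = 1) ∧ coeff d (rescale ω g - g) ≠ 0 := by
  have hp := Complex.isPrimitiveRoot_exp n hn
  obtain ⟨i, hi⟩ : ∃ i, ¬ n ∣ d i := by
    by_contra! hdvd
    choose e he using hdvd
    exact hd ⟨Finsupp.equivFunOnFinite.symm e, by ext i; simp [he]⟩
  refine ⟨Function.update 1 i (Complex.exp (2 * Real.pi * Complex.I / n)), fun j => ?_, ?_⟩
  · by_cases hj : j = i
    · subst hj; simpa using hp.pow_eq_one
    · simp [hj]
  · rw [map_sub, coeff_rescale, Finsupp.prod_fintype _ _ (by simp), Finset.prod_eq_single i]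
    · rw [Function.update_self, ← sub_one_mul]
      exact mul_ne_zero (sub_ne_zero.2 fun h => hi ((hp.pow_eq_one_iff_dvd _).1 h)) hc
    · intro j _ hj
      simp [hj]
    · simp

lemma eq_expand_of_rescale (hn : n ≠ 0) {g : Series}
    (hg : ∀ ω : Fin 2 → ℂ, (∀ i, ω i ^ n = 1) → rescale ω g = g) :
    ∃ g' : Series, expand n hn g' = g := by
  let g' : Series := fun d => coeff (n • d) g
  have hg' : ∀ d, coeff d g' = coeff (n • d) g := fun d => rfl
  refine ⟨g', ?_⟩
  ext d
  by_cases hd : d ∈ Set.range fun d : Fin 2 →₀ ℕ => n • d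
  · obtain ⟨e, rfl⟩ := hd
    simp only [coeff_expand_smul, hg']
  · rw [coeff_expand_of_not_mem_range hn _ hd]
    by_contra hc
    obtain ⟨ω, hω, h⟩ := exists_coeff_rescale_sub_ne_zero hn hd (Ne.symm hc)
    rw [hg ω hω, sub_self, map_zero] at h
    exact h rfl

end Expand

namespace FracSeries

variable (ζ : FracSeries)

lemma mem_conjugates {h : Series} :
    h ∈ ζ.conjugates ↔ ∃ ω : Fin 2 → ℂ, (∀ i, ω i ^ ζ.n = 1) ∧ rescale ω ζ.H = h := by
  have hn := Nat.pos_of_ne_zero ζ.n_ne_zero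
  simp only [conjugates, Finset.mem_image, Finset.mem_product, Polynomial.mem_nthRootsFinset hn]
  constructor
  · rintro ⟨⟨a, b⟩, ⟨ha, hb⟩, rfl⟩
    exact ⟨![a, b], by simpa [Fin.forall_fin_two] using ⟨ha, hb⟩, rfl⟩
  · rintro ⟨ω, hω, rfl⟩
    refine ⟨(ω 0, ω 1), ⟨hω 0, hω 1⟩, ?_⟩
    congr 2
    ext i; fin_cases i <;> rfl

lemma H_mem_conjugates : ζ.H ∈ ζ.conjugates :=
  ζ.mem_conjugates.2 ⟨1, by simp, by simp⟩

lemma rescale_mem_conjugates {ω : Fin 2 → ℂ} (hω : ∀ i, ω i ^ ζ.n = 1) {h : Series}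
    (hh : h ∈ ζ.conjugates) : rescale ω h ∈ ζ.conjugates := by
  obtain ⟨τ, hτ, rfl⟩ := ζ.mem_conjugates.1 hh
  exact ζ.mem_conjugates.2 ⟨τ * ω, fun i => by simp [mul_pow, hτ, hω], (rescale_rescale _ _ _).symm⟩

/-- All differences of conjugates of `ζ` are monomials times units, and `ζ` vanishes at the origin.
This is the condition for `ζ` to parametrize some quasi-ordinary germ. -/
def HasMonomialDifferences : Prop :=
  constantCoeff ζ.H = 0 ∧
    ∀ ω : Fin 2 → ℂ, (∀ i, ω i ^ ζ.n = 1) → ZeroOrMonomial (rescale ω ζ.H - ζ.H)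

/-- The points `(t ^ n, s ^ n, H(t, s))`. -/
def paramSet : Set Space :=
  {q | ∃ t s : ℂ, t ^ ζ.n = q.1 ∧ s ^ ζ.n = q.2.1 ∧ value ζ.H t s = q.2.2}

variable {ζ}

lemma ne_zero_of_pow_eq_one {ω : Fin 2 → ℂ} (hω : ∀ i, ω i ^ ζ.n = 1) (i : Fin 2) : ω i ≠ 0 := by
  intro h
  have := hω i
  rw [h, zero_pow ζ.n_ne_zero] at this
  exact zero_ne_one this

/-- Every difference of conjugates is obtained from some `H(ω₁ t, ω₂ s) - H(t, s)` by multiplying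
the variables with roots of unity. -/
lemma exists_rescale_sub {h h' : Series} (hh : h ∈ ζ.conjugates) (hh' : h' ∈ ζ.conjugates) :
    ∃ ω τ : Fin 2 → ℂ, (∀ i, ω i ^ ζ.n = 1) ∧ (∀ i, τ i ^ ζ.n = 1) ∧
      h - h' = rescale τ (rescale ω ζ.H - ζ.H) := by
  obtain ⟨ω, hω, rfl⟩ := ζ.mem_conjugates.1 hh
  obtain ⟨τ, hτ, rfl⟩ := ζ.mem_conjugates.1 hh'
  refine ⟨ω * τ⁻¹, τ, fun i => by simp [mul_pow, hω, hτ], hτ, ?_⟩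
  rw [map_sub, rescale_rescale]
  congr 3
  ext i
  simp [ne_zero_of_pow_eq_one hτ i]

lemma HasMonomialDifferences.sub {h h' : Series} (H : ζ.HasMonomialDifferences)
    (hh : h ∈ ζ.conjugates) (hh' : h' ∈ ζ.conjugates) : ZeroOrMonomial (h - h') := by
  obtain ⟨ω, τ, hω, hτ, heq⟩ := exists_rescale_sub hh hh'
  rw [heq]
  exact (H.2 ω hω).rescale (ne_zero_of_pow_eq_one hτ)

lemma natDegree_conj_prod (s : Finset Series) :
    (∏ h ∈ s, (Polynomial.X - Polynomial.C h)).natDegree = s.card := by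
  rw [Polynomial.natDegree_prod_of_monic _ _ fun h _ => Polynomial.monic_X_sub_C h]
  simp

lemma monic_conj_prod (s : Finset Series) :
    (∏ h ∈ s, (Polynomial.X - Polynomial.C h)).Monic :=
  Polynomial.monic_prod_of_monic _ _ fun h _ => Polynomial.monic_X_sub_C h

/-- `∏ (z - ζ_i)` has coefficients in the power series in `x`, `y`: they are fixed by the action of
the roots of unity. -/
lemma exists_map_expand_eq_prod (ζ : FracSeries) : ∃ f : Polynomial Series, f.Monic ∧
    f.map (expand ζ.n ζ.n_ne_zero : Series →ₐ[ℂ] Series).toRingHom =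
      ∏ h ∈ ζ.conjugates, (Polynomial.X - Polynomial.C h) := by
  classical
  set Q := ∏ h ∈ ζ.conjugates, (Polynomial.X - Polynomial.C h) with hQ
  have hinv : ∀ ω : Fin 2 → ℂ, (∀ i, ω i ^ ζ.n = 1) → Q.map (rescale ω) = Q := fun ω hω => by
    have hinj : Function.Injective (rescale ω : Series →+* Series) := by
      rw [injective_iff_map_eq_zero]
      intro g hg
      ext d
      by_contra hc
      have := (coeff_rescale_ne_zero (ne_zero_of_pow_eq_one hω) g d).2 hc
      rw [hg] at this
      exact this (by simp)
    have himg : ζ.conjugates.image (rescale ω) = ζ.conjugates :=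
      Finset.eq_of_subset_of_card_le
        (Finset.image_subset_iff.2 fun h hh => ζ.rescale_mem_conjugates hω hh)
        (by rw [Finset.card_image_of_injective _ hinj])
    rw [hQ, Polynomial.map_prod]
    conv_rhs => rw [← himg, Finset.prod_image fun _ _ _ _ h => hinj h]
    simp
  have hlift : Q ∈ Polynomial.lifts (expand ζ.n ζ.n_ne_zero : Series →ₐ[ℂ] Series).toRingHom := by
    rw [Polynomial.lifts_iff_coeff_lifts]
    intro i
    obtain ⟨g, hg⟩ := eq_expand_of_rescale ζ.n_ne_zero (g := Q.coeff i) fun ω hω => by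
      conv_rhs => rw [← hinv ω hω, Polynomial.coeff_map]
    exact ⟨g, hg⟩
  obtain ⟨f, hf, -, hm⟩ := Polynomial.lifts_and_degree_eq_and_monic hlift (monic_conj_prod _)
  exact ⟨f, hm, hf⟩

lemma absConv_of_mem_conjugates {r : ℝ} (hr : 0 ≤ r) (H : AbsConv r ζ.H) {h : Series}
    (hh : h ∈ ζ.conjugates) : AbsConv r h := by
  obtain ⟨ω, hω, rfl⟩ := ζ.mem_conjugates.1 hh
  refine H.rescale hr fun i => le_of_eq ?_
  exact Complex.norm_eq_one_of_pow_eq_one (hω i) ζ.n_ne_zero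

/-- The polynomial `∏ (z - ζ_i)` over the ring of series converging on a polydisc. -/
lemma exists_map_subtype_eq_prod {r : ℝ} (hr : 0 ≤ r) (H : AbsConv r ζ.H) :
    ∃ Q : Polynomial (absConvSubring (Fin 2) hr), Q.natDegree = ζ.conjugates.card ∧
      Q.map (absConvSubring (Fin 2) hr).subtype =
        ∏ h ∈ ζ.conjugates, (Polynomial.X - Polynomial.C h) ∧
      ∀ (v : Fin 2 → ℂ) (hv : ∀ i, ‖v i‖ ≤ r) (z : ℂ),
        Q.eval₂ (evalHom hr hv) z = ∏ h ∈ ζ.conjugates, (z - evalAt h v) := by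
  let Q : Polynomial (absConvSubring (Fin 2) hr) := ∏ h ∈ ζ.conjugates.attach,
    (Polynomial.X - Polynomial.C ⟨h.1, absConv_of_mem_conjugates hr H h.2⟩)
  refine ⟨Q, ?_, ?_, fun v hv z => ?_⟩
  · rw [Polynomial.natDegree_prod_of_monic _ _ fun h _ => Polynomial.monic_X_sub_C _]
    simp
  · rw [Polynomial.map_prod, ← Finset.prod_attach ζ.conjugates]
    simp
  · rw [Polynomial.eval₂_finsetProd, ← Finset.prod_attach ζ.conjugates]
    simp [evalHom]

/-- The zero set of `∏ (z - ζ_i)` consists near the origin of the points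
`(t ^ n, s ^ n, H(t, s))`. -/
lemma zeroLocus_eventuallyEq_paramSet (hH : Convergent ζ.H) {f : Polynomial Series}
    (hf : f.map (expand ζ.n ζ.n_ne_zero : Series →ₐ[ℂ] Series).toRingHom =
      ∏ h ∈ ζ.conjugates, (Polynomial.X - Polynomial.C h)) (hm : f.Monic) :
    zeroLocus f =ᶠ[𝓝 (0 : Space)] ζ.paramSet := by
  obtain ⟨r, hr, hr'⟩ := convergent_iff.1 hH
  obtain ⟨Q, hQd, hQ, hQe⟩ := exists_map_subtype_eq_prod hr.le hr'
  have hn := Nat.pos_of_ne_zero ζ.n_ne_zero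
  have hball : ∀ᶠ q in 𝓝 (0 : Space), ‖q‖ < r ^ ζ.n := by
    have := Metric.ball_mem_nhds (0 : Space) (pow_pos hr ζ.n)
    filter_upwards [this] with q hq
    simpa using hq
  filter_upwards [hball] with q hq
  have hx : ‖q.1‖ ≤ r ^ ζ.n := (norm_fst_le q).trans hq.le
  have hy : ‖q.2.1‖ ≤ r ^ ζ.n := ((norm_fst_le q.2).trans (norm_snd_le q)).trans hq.le
  have hfd : f.natDegree = Q.natDegree := by
    rw [hQd, ← natDegree_conj_prod, ← hf, hm.natDegree_map]
  have key : ∀ t s : ℂ, t ^ ζ.n = q.1 → s ^ ζ.n = q.2.1 →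
      ∑ i ∈ Finset.range (f.natDegree + 1), value (f.coeff i) q.1 q.2.1 * q.2.2 ^ i =
        ∏ h ∈ ζ.conjugates, (q.2.2 - evalAt h ![t, s]) := fun t s ht hs => by
    have hv : ∀ i, ‖(![t, s] : Fin 2 → ℂ) i‖ ≤ r := by
      rw [Fin.forall_fin_two]
      constructor
      · rw [← ht, norm_pow] at hx
        exact le_of_pow_le_pow_left₀ ζ.n_ne_zero hr.le hx
      · rw [← hs, norm_pow] at hy
        exact le_of_pow_le_pow_left₀ ζ.n_ne_zero hr.le hy
    rw [← hQe _ hv, Polynomial.eval₂_eq_sum_range, hfd]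
    refine Finset.sum_congr rfl fun i _ => ?_
    congr 1
    have h1 : expand ζ.n ζ.n_ne_zero (f.coeff i) = (Q.coeff i).1 := by
      have h2 := congrArg (fun P => Polynomial.coeff P i) (hf.trans hQ.symm)
      simp only [Polynomial.coeff_map] at h2
      exact h2
    have h3 : value (f.coeff i) q.1 q.2.1 =
        evalAt (expand ζ.n ζ.n_ne_zero (f.coeff i)) ![t, s] := by
      rw [evalAt_expand, value_eq_evalAt, ← ht, ← hs]
      congr 1
      ext i; fin_cases i <;> simp
    rw [h3, h1]
    rfl
  have hmem : q ∈ zeroLocus f ↔ q ∈ ζ.paramSet := by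
    constructor
    · intro h
      obtain ⟨t, ht⟩ := IsAlgClosed.exists_pow_nat_eq q.1 hn
      obtain ⟨s, hs⟩ := IsAlgClosed.exists_pow_nat_eq q.2.1 hn
      have h0 : ∏ h ∈ ζ.conjugates, (q.2.2 - evalAt h ![t, s]) = 0 := by
        rw [← key t s ht hs]; exact h
      obtain ⟨h, hh, hz⟩ := Finset.prod_eq_zero_iff.1 h0
      obtain ⟨ω, hω, rfl⟩ := ζ.mem_conjugates.1 hh
      refine ⟨ω 0 * t, ω 1 * s, by rw [mul_pow, hω, one_mul, ht], by rw [mul_pow, hω, one_mul, hs],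
        ?_⟩
      rw [sub_eq_zero.1 hz, evalAt_rescale, value_eq_evalAt]
      congr 1
      ext i; fin_cases i <;> simp
    · rintro ⟨t, s, ht, hs, hz⟩
      change ∑ i ∈ Finset.range (f.natDegree + 1), _ = _
      rw [key t s ht hs]
      refine Finset.prod_eq_zero ζ.H_mem_conjugates ?_
      rw [← value_eq_evalAt, hz, sub_self]
  exact propext hmem

end FracSeries

/-- A parametrization can be recognized without reference to the equation `f`: the series must have
monomial differences, and near the origin `V` must be the image of the parametrizing map. -/
theorem isParametrization_iff {V : Set Space} {ζ : FracSeries} :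
    IsParametrization V ζ ↔
      Convergent ζ.H ∧ ζ.HasMonomialDifferences ∧ V =ᶠ[𝓝 (0 : Space)] ζ.paramSet := by
  classical
  have hne : ζ.conjugates.Nonempty := ⟨_, ζ.H_mem_conjugates⟩
  set φ : Series →+* Series := (expand ζ.n ζ.n_ne_zero : Series →ₐ[ℂ] Series).toRingHom
  have hφ' : ∀ g, φ g = expand ζ.n ζ.n_ne_zero g := fun g => rfl
  have hdiscr : ∀ {f : Polynomial Series}, f.Monic →
      f.map φ = ∏ h ∈ ζ.conjugates, (Polynomial.X - Polynomial.C h) →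
      ∃ k : ℕ, φ f.discr =
        (-1) ^ k * ∏ h ∈ ζ.conjugates, ∏ h' ∈ ζ.conjugates.erase h, (h - h') :=
    fun {f} hm hf => by
      have hd : 0 < f.natDegree := by
        rw [← hm.natDegree_map φ, hf, FracSeries.natDegree_conj_prod]
        exact hne.card_pos
      rw [map_discr φ hm hd, hf]
      exact discr_prod_X_sub_C hne
  constructor
  · rintro ⟨hH, f, hq, hV, hf⟩
    refine ⟨hH, ⟨?_, fun ω hω => ?_⟩,
      hV.trans (FracSeries.zeroLocus_eventuallyEq_paramSet hH hf hq.monic)⟩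
    · -- Modulo the maximal ideal, `f` is a power of `z`, and the constant term of `H` is a root.
      have h1 : (f.map φ).map (constantCoeff (σ := Fin 2) (R := ℂ)) =
          Polynomial.X ^ f.natDegree := by
        ext i
        rw [Polynomial.coeff_map, Polynomial.coeff_map, hφ', constantCoeff_expand,
          Polynomial.coeff_X_pow]
        rcases lt_trichotomy i f.natDegree with h | rfl | h
        · rw [if_neg h.ne, hq.vanish i h]
        · rw [if_pos rfl, hq.monic.coeff_natDegree, map_one]
        · rw [if_neg h.ne', Polynomial.coeff_eq_zero_of_natDegree_lt h, map_zero]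
      have h2 := congrArg (Polynomial.eval (constantCoeff ζ.H)) h1
      rw [hf, Polynomial.map_prod, Polynomial.eval_prod,
        Finset.prod_eq_zero ζ.H_mem_conjugates (by simp)] at h2
      rw [Polynomial.eval_pow, Polynomial.eval_X] at h2
      by_contra hc
      exact pow_ne_zero _ hc h2.symm
    · by_cases h0 : rescale ω ζ.H = ζ.H
      · exact Or.inl (sub_eq_zero.2 h0)
      right
      obtain ⟨a, b, ε, hε, hab⟩ := hq.discr
      obtain ⟨k, hk⟩ := hdiscr hq.monic hf
      have hmono : IsMonomialTimesUnit
          ((-1) ^ k * ∏ h ∈ ζ.conjugates, ∏ h' ∈ ζ.conjugates.erase h, (h - h'))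
          (ζ.n * a) (ζ.n * b) := by
        rw [← hk, hab, hφ']
        exact ⟨expand ζ.n ζ.n_ne_zero ε, by rwa [constantCoeff_expand], by simp [pow_mul]⟩
      have hmem : rescale ω ζ.H ∈ ζ.conjugates := ζ.mem_conjugates.2 ⟨ω, hω, rfl⟩
      rw [← Finset.mul_prod_erase _ _ hmem, ← Finset.mul_prod_erase _ _
        (Finset.mem_erase.2 ⟨Ne.symm h0, ζ.H_mem_conjugates⟩)] at hmono
      rw [mul_left_comm, mul_assoc] at hmono
      exact hmono.of_mul
  · rintro ⟨hH, hM, hV⟩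
    obtain ⟨f, hm, hf⟩ := ζ.exists_map_expand_eq_prod
    obtain ⟨r, hr, hr'⟩ := convergent_iff.1 hH
    refine ⟨hH, f, ⟨hm, fun i => ?_, fun i hi => ?_, ?_⟩,
      hV.trans (FracSeries.zeroLocus_eventuallyEq_paramSet hH hf hm).symm, hf⟩
    · rw [← convergent_expand_iff ζ.n_ne_zero, ← hφ', ← Polynomial.coeff_map, hf]
      obtain ⟨Q, -, hQ, -⟩ := FracSeries.exists_map_subtype_eq_prod hr.le hr'
      rw [← hQ, Polynomial.coeff_map]
      exact convergent_iff.2 ⟨r, hr, (Q.coeff i).2⟩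
    · have h1 : (f.map φ).map (constantCoeff (σ := Fin 2) (R := ℂ)) =
          Polynomial.X ^ ζ.conjugates.card := by
        rw [hf, Polynomial.map_prod, ← Finset.prod_const]
        refine Finset.prod_congr rfl fun h hh => ?_
        obtain ⟨ω, -, rfl⟩ := ζ.mem_conjugates.1 hh
        have : constantCoeff (rescale ω ζ.H) = 0 := by
          rw [← coeff_zero_eq_constantCoeff_apply, coeff_rescale, coeff_zero_eq_constantCoeff_apply,
            hM.1, mul_zero]
        simp [this]
      have h2 := congrArg (fun P => Polynomial.coeff P i) h1
      simp only [Polynomial.coeff_map, hφ', constantCoeff_expand, Polynomial.coeff_X_pow] at h2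
      rw [h2, if_neg]
      rw [← FracSeries.natDegree_conj_prod, ← hf, hm.natDegree_map]
      exact hi.ne
    · obtain ⟨k, hk⟩ := hdiscr hm hf
      have hmono : ∃ u v, IsMonomialTimesUnit
          ((-1) ^ k * ∏ h ∈ ζ.conjugates, ∏ h' ∈ ζ.conjugates.erase h, (h - h')) u v := by
        have hprod : ∀ (s : Finset Series) (g : Series → Series),
            (∀ h ∈ s, ∃ u v, IsMonomialTimesUnit (g h) u v) →
            ∃ u v, IsMonomialTimesUnit (∏ h ∈ s, g h) u v := fun s g => by
          refine Finset.prod_induction g (fun h => ∃ u v, IsMonomialTimesUnit h u v) ?_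
            ⟨0, 0, isMonomialTimesUnit_of_unit (by simp)⟩
          rintro g h ⟨u, v, hg⟩ ⟨u', v', hh⟩
          exact ⟨_, _, hg.mul hh⟩
        obtain ⟨u, v, huv⟩ := hprod ζ.conjugates _ fun h hh =>
          hprod (ζ.conjugates.erase h) (fun h' => h - h') fun h' hh' =>
            (hM.sub hh (Finset.mem_of_mem_erase hh')).resolve_left
              (sub_ne_zero.2 (Finset.ne_of_mem_erase hh').symm)
        exact ⟨_, _, (isMonomialTimesUnit_of_unit (by simp)).mul huv⟩
      obtain ⟨u, v, huv⟩ := hmono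
      rw [← hk, hφ'] at huv
      exact huv.of_expand ζ.n_ne_zero

end Characterization

/-! ### Coordinate changes, smoothness, and subtraction of the integral part -/

section Convergence

open MvPowerSeries

lemma Convergent.sub {g h : Series} (hg : Convergent g) (hh : Convergent h) :
    Convergent (g - h) := by
  obtain ⟨r, hr, hg⟩ := convergent_iff.1 hg
  obtain ⟨r', hr', hh⟩ := convergent_iff.1 hh
  have h0 : 0 < min r r' := lt_min hr hr'
  rw [sub_eq_add_neg]
  exact convergent_iff.2 ⟨min r r', h0, (hg.mono h0.le (min_le_left _ _)).add h0.le
    (hh.mono h0.le (min_le_right _ _)).neg⟩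

/-- Convergent series are evaluated compatibly with subtraction on a neighbourhood of the origin. -/
lemma Convergent.evalAt_sub {g h : Series} (hg : Convergent g) (hh : Convergent h) :
    ∃ r > 0, ∀ v : Fin 2 → ℂ, (∀ i, ‖v i‖ ≤ r) → evalAt (g - h) v = evalAt g v - evalAt h v := by
  obtain ⟨r, hr, hg⟩ := convergent_iff.1 hg
  obtain ⟨r', hr', hh⟩ := convergent_iff.1 hh
  have h0 : 0 < min r r' := lt_min hr hr'
  refine ⟨_, h0, fun v hv => ?_⟩
  exact map_sub (evalHom h0.le hv) ⟨g, hg.mono h0.le (min_le_left _ _)⟩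
    ⟨h, hh.mono h0.le (min_le_right _ _)⟩

lemma evalAt_zero_right {κ : Type*} [Fintype κ] (h : MvPowerSeries κ ℂ) :
    evalAt h 0 = constantCoeff h := by
  unfold evalAt
  rw [tsum_eq_single 0]
  · simp
  · intro d hd
    obtain ⟨i, hi⟩ := Finsupp.ne_iff.1 hd
    rw [Finset.prod_eq_zero (Finset.mem_univ i) (by simpa using hi), mul_zero]

lemma analyticAt_vec {E : Type*} [NormedAddCommGroup E] [NormedSpace ℂ E] {a b : E → ℂ} {e : E}
    (ha : AnalyticAt ℂ a e) (hb : AnalyticAt ℂ b e) :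
    AnalyticAt ℂ (fun q => (![a q, b q] : Fin 2 → ℂ)) e := by
  refine AnalyticAt.pi fun i => ?_
  fin_cases i
  · exact ha
  · exact hb

lemma Convergent.analyticAt_value {E : Type*} [NormedAddCommGroup E] [NormedSpace ℂ E]
    {h : Series} (hh : Convergent h) {a b : E → ℂ} {e : E} (ha : AnalyticAt ℂ a e)
    (hb : AnalyticAt ℂ b e) (ha0 : a e = 0) (hb0 : b e = 0) :
    AnalyticAt ℂ (fun q => value h (a q) (b q)) e := by
  obtain ⟨r, hr, hh⟩ := convergent_iff.1 hh
  simp only [value_eq_evalAt]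
  have h1 : (![a e, b e] : Fin 2 → ℂ) = 0 := by rw [ha0, hb0]; simp
  exact AnalyticAt.fun_comp (g := evalAt h) (by rw [h1]; exact hh.analyticAt hr)
    (analyticAt_vec ha hb)

lemma value_zero (h : Series) : value h 0 0 = constantCoeff h := by
  rw [value_eq_evalAt, ← evalAt_zero_right]
  congr 1
  simp

end Convergence

section Smoothness

/-- Near the origin, the image of a germ under a coordinate change depends only on the germ. -/
lemma image_eventuallyEq {φ ψ : Space → Space} (hl : Function.LeftInverse ψ φ)
    (hr : Function.RightInverse ψ φ) (hψ : Tendsto ψ (𝓝 0) (𝓝 0)) {V W : Set Space}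
    (h : V =ᶠ[𝓝 (0 : Space)] W) : φ '' V =ᶠ[𝓝 (0 : Space)] φ '' W := by
  filter_upwards [hψ.eventually h] with q hq
  have h1 : ∀ U : Set Space, (φ '' U) q = U (ψ q) := fun U =>
    propext (Set.mem_image_iff_of_inverse hl hr)
  rw [h1, h1, hq]

/-- Smoothness is invariant under analytic coordinate changes. -/
lemma IsSmoothGerm.of_image {φ ψ : Space → Space} (hl : Function.LeftInverse ψ φ)
    (hr : Function.RightInverse ψ φ) (hφ : AnalyticAt ℂ φ 0) (hψ : AnalyticAt ℂ ψ 0)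
    (hφ0 : φ 0 = 0) {V : Set Space} (h : IsSmoothGerm (φ '' V)) : IsSmoothGerm V := by
  obtain ⟨g, hg, hg0, hdg, hV⟩ := h
  have hψ0 : ψ 0 = 0 := by conv_lhs => rw [← hφ0, hl 0]
  have hg' : AnalyticAt ℂ g (φ 0) := by rwa [hφ0]
  have hgφ : AnalyticAt ℂ (g ∘ φ) 0 := hg'.comp hφ
  refine ⟨g ∘ φ, hgφ, by simp [hφ0, hg0], fun hd => hdg ?_, ?_⟩
  · have h1 : g = (g ∘ φ) ∘ ψ := by
      ext q; simp [hr q]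
    have h2 : fderiv ℂ (g ∘ φ) (ψ 0) = 0 := by rw [hψ0, hd]
    rw [h1, fderiv_comp _ (by rw [hψ0]; exact hgφ.differentiableAt) hψ.differentiableAt, h2,
      ContinuousLinearMap.zero_comp]
  · have htend : Tendsto φ (𝓝 0) (𝓝 0) := by
      have := hφ.continuousAt.tendsto
      rwa [hφ0] at this
    filter_upwards [htend.eventually hV] with q hq
    have h1 : (φ '' V) (φ q) = V q := propext (hl.injective.mem_set_image)
    rw [← h1, hq]
    rfl

lemma analyticAt_x : AnalyticAt ℂ (fun q : Space => q.1) 0 := _root_.analyticAt_fst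

lemma analyticAt_y : AnalyticAt ℂ (fun q : Space => q.2.1) 0 :=
  _root_.analyticAt_fst.fun_comp _root_.analyticAt_snd

lemma analyticAt_z : AnalyticAt ℂ (fun q : Space => q.2.2) 0 :=
  _root_.analyticAt_snd.fun_comp _root_.analyticAt_snd

/-- The inverse of `shear p`. -/
def unshear (p : Series) (q : Space) : Space := (q.1, q.2.1, q.2.2 + value p q.1 q.2.1)

lemma leftInverse_shear (p : Series) : Function.LeftInverse (unshear p) (shear p) := fun q => by
  simp [shear, unshear]

lemma rightInverse_shear (p : Series) : Function.RightInverse (unshear p) (shear p) := fun q => by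
  simp [shear, unshear]

lemma analyticAt_shear {p : Series} (hp : Convergent p) : AnalyticAt ℂ (shear p) 0 :=
  analyticAt_x.prod (analyticAt_y.prod (analyticAt_z.sub
    (hp.analyticAt_value analyticAt_x analyticAt_y rfl rfl)))

lemma analyticAt_unshear {p : Series} (hp : Convergent p) : AnalyticAt ℂ (unshear p) 0 :=
  analyticAt_x.prod (analyticAt_y.prod (analyticAt_z.add
    (hp.analyticAt_value analyticAt_x analyticAt_y rfl rfl)))

lemma analyticAt_swapXZ : AnalyticAt ℂ swapXZ 0 :=
  analyticAt_z.prod (analyticAt_y.prod analyticAt_x)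

lemma analyticAt_swapXY : AnalyticAt ℂ swapXY 0 :=
  analyticAt_y.prod (analyticAt_x.prod analyticAt_z)

lemma swapXZ_swapXZ : Function.LeftInverse swapXZ swapXZ := fun _ => rfl

lemma swapXY_swapXY : Function.LeftInverse swapXY swapXY := fun _ => rfl

/-- The graph of a convergent series is smooth. -/
lemma isSmoothGerm_graph {p : Series} (hp : Convergent p) (hp0 : MvPowerSeries.constantCoeff p = 0)
    {V : Set Space} (hV : V =ᶠ[𝓝 (0 : Space)] {q | q.2.2 = value p q.1 q.2.1}) :
    IsSmoothGerm V := by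
  have hval : AnalyticAt ℂ (fun q : Space => value p q.1 q.2.1) 0 :=
    hp.analyticAt_value analyticAt_x analyticAt_y rfl rfl
  refine ⟨fun q => q.2.2 - value p q.1 q.2.1, analyticAt_z.sub hval, ?_, fun hd => ?_, ?_⟩
  · simp [value_zero, hp0]
  · -- The derivative in the direction of `z` is one.
    have h1 : HasFDerivAt (fun q : Space => q.2.2 - value p q.1 q.2.1) (0 : Space →L[ℂ] ℂ) 0 := by
      rw [← hd]
      exact (analyticAt_z.sub hval).differentiableAt.hasFDerivAt
    let ι : ℂ →L[ℂ] Space :=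
      (ContinuousLinearMap.inr ℂ ℂ (ℂ × ℂ)).comp (ContinuousLinearMap.inr ℂ ℂ ℂ)
    have h1' : HasFDerivAt (fun q : Space => q.2.2 - value p q.1 q.2.1) (0 : Space →L[ℂ] ℂ)
        (ι 0) := by simpa using h1
    have h2 := (h1'.comp (0 : ℂ) ι.hasFDerivAt).hasDerivAt
    have h3 : HasDerivAt (fun z : ℂ => z - value p 0 0) 1 0 := (hasDerivAt_id _).sub_const _
    have h4 := h3.unique h2
    simp at h4
  · refine hV.trans (Eventually.of_forall fun q => ?_)
    exact propext sub_eq_zero.symm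

end Smoothness

section Subtraction

open MvPowerSeries

variable {ζ : FracSeries}

lemma coeff_integralPart (d : Fin 2 →₀ ℕ) : coeff d ζ.integralPart = coeff (ζ.n • d) ζ.H := rfl

lemma convergent_integralPart (h : Convergent ζ.H) : Convergent ζ.integralPart := by
  obtain ⟨r, hr, h⟩ := convergent_iff.1 h
  refine convergent_iff.2 ⟨r ^ ζ.n, pow_pos hr _, ?_⟩
  refine (h.comp_injective (nsmul_injective_of_ne_zero ζ.n_ne_zero)).congr fun d => ?_
  simp [coeff_integralPart, pow_mul]

lemma constantCoeff_integralPart (h : constantCoeff ζ.H = 0) :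
    constantCoeff ζ.integralPart = 0 := by
  rw [← coeff_zero_eq_constantCoeff_apply, coeff_integralPart, smul_zero,
    coeff_zero_eq_constantCoeff_apply, h]

/-- Subtracting the integral part gives a parametrization of the sheared germ. -/
lemma IsParametrization.subIntegralPart {V : Set Space} (h : IsParametrization V ζ) :
    IsParametrization (shear ζ.integralPart '' V) ζ.subIntegralPart := by
  rw [isParametrization_iff] at *
  obtain ⟨hH, ⟨h0, hM⟩, hV⟩ := h
  have hp := convergent_integralPart hH
  have hp' := (convergent_expand_iff ζ.n_ne_zero).2 hp
  have hp0 := constantCoeff_integralPart h0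
  refine ⟨hH.sub hp', ⟨?_, fun ω hω => ?_⟩, ?_⟩
  · change constantCoeff (ζ.H - expand ζ.n ζ.n_ne_zero ζ.integralPart) = 0
    rw [map_sub, h0, constantCoeff_expand, hp0, sub_zero]
  · have := hM ω hω
    change ZeroOrMonomial (rescale ω (ζ.H - expand ζ.n ζ.n_ne_zero ζ.integralPart) -
      (ζ.H - expand ζ.n ζ.n_ne_zero ζ.integralPart))
    rwa [map_sub, rescale_expand ζ.n_ne_zero hω, sub_sub_sub_cancel_right]
  · have hψ : Tendsto (unshear ζ.integralPart) (𝓝 0) (𝓝 0) := by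
      have := (analyticAt_unshear hp).continuousAt.tendsto
      rwa [show unshear ζ.integralPart 0 = 0 by simp [unshear, value_zero, hp0]] at this
    refine (image_eventuallyEq (leftInverse_shear _) (rightInverse_shear _) hψ hV).trans ?_
    obtain ⟨r, hr, hsub⟩ := hH.evalAt_sub hp'
    have hball : ∀ᶠ q in 𝓝 (0 : Space), ‖q‖ < r ^ ζ.n := by
      filter_upwards [Metric.ball_mem_nhds (0 : Space) (pow_pos hr ζ.n)] with q hq
      simpa using hq
    filter_upwards [hball] with q hq
    have hx : ‖q.1‖ ≤ r ^ ζ.n := (norm_fst_le q).trans hq.le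
    have hy : ‖q.2.1‖ ≤ r ^ ζ.n := ((norm_fst_le q.2).trans (norm_snd_le q)).trans hq.le
    have key : ∀ t s : ℂ, t ^ ζ.n = q.1 → s ^ ζ.n = q.2.1 →
        value ζ.subIntegralPart.H t s = value ζ.H t s - value ζ.integralPart q.1 q.2.1 :=
        fun t s ht hs => by
      have hv : ∀ i, ‖(![t, s] : Fin 2 → ℂ) i‖ ≤ r := by
        rw [Fin.forall_fin_two]
        constructor
        · rw [← ht, norm_pow] at hx
          exact le_of_pow_le_pow_left₀ ζ.n_ne_zero hr.le hx
        · rw [← hs, norm_pow] at hy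
          exact le_of_pow_le_pow_left₀ ζ.n_ne_zero hr.le hy
      rw [value_eq_evalAt, value_eq_evalAt, value_eq_evalAt]
      refine (hsub _ hv).trans ?_
      rw [evalAt_expand, ← ht, ← hs]
      congr 2
      ext i; fin_cases i <;> simp
    refine propext ((Set.mem_image_iff_of_inverse (leftInverse_shear _)
      (rightInverse_shear _)).trans ?_)
    constructor
    · rintro ⟨t, s, ht, hs, hz⟩
      refine ⟨t, s, ht, hs, ?_⟩
      rw [key t s ht hs, hz]
      simp [unshear]
    · rintro ⟨t, s, ht, hs, hz⟩
      refine ⟨t, s, ht, hs, ?_⟩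
      rw [key t s ht hs] at hz
      simp [unshear, ← hz]

/-- A parametrization without fractional terms parametrizes a smooth germ. -/
lemma IsParametrization.isSmoothGerm {V : Set Space} (h : IsParametrization V ζ)
    (h0 : ζ.subIntegralPart.H = 0) : IsSmoothGerm V := by
  obtain ⟨hH, ⟨hH0, -⟩, hV⟩ := isParametrization_iff.1 h
  refine isSmoothGerm_graph (convergent_integralPart hH) (constantCoeff_integralPart hH0)
    (hV.trans (Eventually.of_forall fun q => propext ?_))
  have hn := Nat.pos_of_ne_zero ζ.n_ne_zero
  have key : ∀ t s : ℂ, value ζ.H t s = value ζ.integralPart (t ^ ζ.n) (s ^ ζ.n) := fun t s => by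
    have h1 : ζ.H = expand ζ.n ζ.n_ne_zero ζ.integralPart := sub_eq_zero.1 h0
    conv_lhs => rw [h1, value_eq_evalAt, evalAt_expand]
    rw [value_eq_evalAt]
    congr 1
    ext i; fin_cases i <;> simp
  constructor
  · rintro ⟨t, s, ht, hs, hz⟩
    change q.2.2 = _
    rw [← hz, key, ht, hs]
  · intro hz
    obtain ⟨t, ht⟩ := IsAlgClosed.exists_pow_nat_eq q.1 hn
    obtain ⟨s, hs⟩ := IsAlgClosed.exists_pow_nat_eq q.2.1 hn
    exact ⟨t, s, ht, hs, by rw [key, ht, hs]; exact hz.symm⟩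

lemma coeff_subIntegralPart (d : Fin 2 →₀ ℕ) : coeff (ζ.n • d) ζ.subIntegralPart.H = 0 := by
  change coeff (ζ.n • d) (ζ.H - expand ζ.n ζ.n_ne_zero ζ.integralPart) = 0
  rw [map_sub, coeff_expand_smul, coeff_integralPart, sub_self]

/-- The fractional series without integral terms is a monomial times a unit, the exponent being the
least one occurring in the differences of conjugates: each term of `ζ` occurs in some difference,
so it is a multiple of the leading monomial of that difference. -/
lemma FracSeries.HasMonomialDifferences.exists_isMonomialTimesUnit
    (h : ζ.HasMonomialDifferences) (h0 : ζ.H ≠ 0) (hint : ∀ d, coeff (ζ.n • d) ζ.H = 0) :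
    ∃ a b, IsMonomialTimesUnit ζ.H a b ∧ ¬ (ζ.n ∣ a ∧ ζ.n ∣ b) := by
  classical
  have hdiff : ∀ d, coeff d ζ.H ≠ 0 → ∃ u v, u ≤ d 0 ∧ v ≤ d 1 ∧
      ∃ ω : Fin 2 → ℂ, (∀ i, ω i ^ ζ.n = 1) ∧
        IsMonomialTimesUnit (rescale ω ζ.H - ζ.H) u v := fun d hd => by
    have hd' : d ∉ Set.range fun d : Fin 2 →₀ ℕ => ζ.n • d := by
      rintro ⟨e, rfl⟩
      exact hd (hint e)
    obtain ⟨ω, hω, hc⟩ := exists_coeff_rescale_sub_ne_zero ζ.n_ne_zero hd' hd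
    obtain ⟨u, v, huv⟩ := (h.2 ω hω).resolve_left fun h => hc (by rw [h, map_zero])
    have := (isMonomialTimesUnit_iff.1 huv).2 d hc
    exact ⟨u, v, this.1, this.2, ω, hω, huv⟩
  have hex : ∃ N u v, u + v = N ∧ ∃ ω : Fin 2 → ℂ, (∀ i, ω i ^ ζ.n = 1) ∧
      IsMonomialTimesUnit (rescale ω ζ.H - ζ.H) u v := by
    obtain ⟨d, hd⟩ : ∃ d, coeff d ζ.H ≠ 0 := by
      by_contra! hc
      exact h0 (by ext d; simp [hc])
    obtain ⟨u, v, -, -, ω, hω, huv⟩ := hdiff d hd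
    exact ⟨_, u, v, rfl, ω, hω, huv⟩
  obtain ⟨u, v, hN, ω, hω, huv⟩ := Nat.find_spec hex
  have hmin : ∀ u' v' (ω' : Fin 2 → ℂ), (∀ i, ω' i ^ ζ.n = 1) →
      IsMonomialTimesUnit (rescale ω' ζ.H - ζ.H) u' v' → u ≤ u' ∧ v ≤ v' :=
      fun u' v' ω' hω' huv' => by
    have h1 : u + v ≤ u' + v' := by
      rw [hN]
      exact Nat.find_min' hex ⟨u', v', rfl, ω', hω', huv'⟩
    have h2 := huv.comparable huv' (by
      rw [sub_sub_sub_cancel_right]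
      exact h.sub (ζ.mem_conjugates.2 ⟨ω, hω, rfl⟩) (ζ.mem_conjugates.2 ⟨ω', hω', rfl⟩))
    omega
  have hc : coeff (expo u v) ζ.H ≠ 0 := fun hc => by
    refine (isMonomialTimesUnit_iff.1 huv).1 ?_
    rw [map_sub, coeff_rescale, hc, mul_zero, sub_zero]
  refine ⟨u, v, isMonomialTimesUnit_iff.2 ⟨hc, fun d hd => ?_⟩, ?_⟩
  · obtain ⟨u', v', hu, hv, ω', hω', huv'⟩ := hdiff d hd
    have := hmin u' v' ω' hω' huv'
    omega
  · rintro ⟨⟨a, rfl⟩, ⟨b, rfl⟩⟩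
    refine hc ?_
    rw [show expo (ζ.n * a) (ζ.n * b) = ζ.n • expo a b by ext i; fin_cases i <;> simp]
    exact hint _

end Subtraction

/-! ### Exchange of `x` and `y`, and the characteristic pairs -/

section Swap

open MvPowerSeries

/-- Exchanging the two exponents. -/
def swapExpo : Equiv.Perm (Fin 2 →₀ ℕ) :=
  Function.Involutive.toPerm (fun d => expo (d 1) (d 0)) fun d => by
    ext i; fin_cases i <;> simp

@[simp] lemma swapExpo_apply (d : Fin 2 →₀ ℕ) : swapExpo d = expo (d 1) (d 0) := rfl

/-- Exchanging the two variables of a series. -/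
def swapSeries (h : Series) : Series := rename (Equiv.swap (0 : Fin 2) 1) h

lemma coeff_swapSeries (h : Series) (d : Fin 2 →₀ ℕ) :
    coeff d (swapSeries h) = coeff (swapExpo d) h := by
  have h1 := coeff_embDomain_rename (Equiv.swap (0 : Fin 2) 1).toEmbedding h (swapExpo d)
  rw [← h1]
  have h2 : Finsupp.embDomain (Equiv.swap (0 : Fin 2) 1).toEmbedding (swapExpo d) = d := by
    ext i
    fin_cases i
    · have := Finsupp.embDomain_apply_self (Equiv.swap (0 : Fin 2) 1).toEmbedding (swapExpo d) 1
      simpa using this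
    · have := Finsupp.embDomain_apply_self (Equiv.swap (0 : Fin 2) 1).toEmbedding (swapExpo d) 0
      simpa using this
  rw [h2]
  rfl

lemma swapSeries_sub (g h : Series) : swapSeries (g - h) = swapSeries g - swapSeries h :=
  map_sub _ _ _

lemma evalAt_swapSeries (h : Series) (t s : ℂ) :
    evalAt (swapSeries h) ![t, s] = evalAt h ![s, t] := by
  unfold evalAt
  rw [← swapExpo.tsum_eq]
  refine tsum_congr fun d => ?_
  rw [coeff_swapSeries]
  simp [Fin.prod_univ_two, expo_eta, mul_comm]

lemma absConv_swapSeries {r : ℝ} {h : Series} (H : AbsConv r h) : AbsConv r (swapSeries h) := by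
  unfold AbsConv at *
  rw [← swapExpo.summable_iff]
  refine H.congr fun d => ?_
  simp only [Function.comp, coeff_swapSeries]
  simp [Fin.prod_univ_two, expo_eta, mul_comm]

lemma isMonomialTimesUnit_swapSeries {h : Series} {u v : ℕ} (H : IsMonomialTimesUnit h u v) :
    IsMonomialTimesUnit (swapSeries h) v u := by
  rw [isMonomialTimesUnit_iff] at *
  refine ⟨by rw [coeff_swapSeries]; simpa using H.1, fun d hd => ?_⟩
  rw [coeff_swapSeries] at hd
  simpa [and_comm] using H.2 _ hd

lemma swapSeries_swapSeries (h : Series) : swapSeries (swapSeries h) = h := by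
  ext d
  rw [coeff_swapSeries, coeff_swapSeries]
  simp [expo_eta]

lemma rescale_swapSeries (ω : Fin 2 → ℂ) (h : Series) :
    rescale ω (swapSeries h) = swapSeries (rescale ![ω 1, ω 0] h) := by
  ext d
  rw [coeff_swapSeries, coeff_rescale, coeff_rescale, coeff_swapSeries,
    Finsupp.prod_fintype _ _ (by simp), Finsupp.prod_fintype _ _ (by simp)]
  simp [Fin.prod_univ_two, mul_comm]

namespace FracSeries

variable {ζ : FracSeries}

lemma swap_H : ζ.swap.H = swapSeries ζ.H := rfl

lemma rescale_swap_sub (ω : Fin 2 → ℂ) : rescale ω ζ.swap.H - ζ.swap.H =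
    swapSeries (rescale ![ω 1, ω 0] ζ.H - ζ.H) := by
  rw [swap_H, rescale_swapSeries, swapSeries_sub]

variable (ζ) in
/-- The exponents (as monomials in `x^{1/n}`, `y^{1/n}`) of the differences of `ζ` with its
conjugates. -/
def diffExponents : Set (ℕ × ℕ) :=
  {p | ∃ ω : Fin 2 → ℂ, (∀ i, ω i ^ ζ.n = 1) ∧
    IsMonomialTimesUnit (rescale ω ζ.H - ζ.H) p.1 p.2}

lemma swap_mem_diffExponents_swap {p : ℕ × ℕ} (hp : p ∈ ζ.diffExponents) :
    p.swap ∈ ζ.swap.diffExponents := by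
  obtain ⟨ω, hω, h⟩ := hp
  refine ⟨![ω 1, ω 0], by simpa [Fin.forall_fin_two] using ⟨hω 1, hω 0⟩, ?_⟩
  rw [rescale_swap_sub]
  have : (![(![ω 1, ω 0] : Fin 2 → ℂ) 1, (![ω 1, ω 0] : Fin 2 → ℂ) 0] : Fin 2 → ℂ) = ω := by
    ext i; fin_cases i <;> rfl
  rw [this]
  exact isMonomialTimesUnit_swapSeries h

lemma swap_swap : ζ.swap.swap = ζ := by
  cases ζ
  simp only [FracSeries.swap, FracSeries.mk.injEq, true_and]
  exact swapSeries_swapSeries _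

lemma swap_mem_diffExponents_swap_iff {p : ℕ × ℕ} :
    p.swap ∈ ζ.swap.diffExponents ↔ p ∈ ζ.diffExponents := by
  refine ⟨fun h => ?_, swap_mem_diffExponents_swap⟩
  have := swap_mem_diffExponents_swap h
  rwa [swap_swap, Prod.swap_swap] at this

/-- The pair of rational exponents belonging to the exponents in `x^{1/n}`, `y^{1/n}`. -/
def toPair (n : ℕ) (p : ℕ × ℕ) : ℚ × ℚ := ((p.1 : ℚ) / n, (p.2 : ℚ) / n)

lemma toPair_injective {n : ℕ} (hn : n ≠ 0) : Function.Injective (toPair n) := fun p q h => by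
  have hn' : (n : ℚ) ≠ 0 := by exact_mod_cast hn
  simp only [toPair, Prod.mk.injEq, div_left_inj' hn', Nat.cast_inj] at h
  exact Prod.ext h.1 h.2

lemma charPairs_eq : ζ.charPairs = toPair ζ.n '' ζ.diffExponents := by
  ext q
  constructor
  · rintro ⟨h, hh, h', hh', -, u, v, huv, rfl⟩
    obtain ⟨ω, τ, hω, hτ, heq⟩ := exists_rescale_sub hh hh'
    rw [heq, isMonomialTimesUnit_rescale_iff (ne_zero_of_pow_eq_one hτ)] at huv
    exact ⟨(u, v), ⟨ω, hω, huv⟩, rfl⟩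
  · rintro ⟨⟨u, v⟩, ⟨ω, hω, huv⟩, rfl⟩
    exact ⟨_, ζ.mem_conjugates.2 ⟨ω, hω, rfl⟩, ζ.H, ζ.H_mem_conjugates,
      sub_ne_zero.1 huv.ne_zero, u, v, huv, rfl⟩

lemma charPairs_swap : ζ.swap.charPairs = Prod.swap '' ζ.charPairs := by
  rw [charPairs_eq, charPairs_eq]
  ext q
  simp only [Set.mem_image, exists_exists_and_eq_and]
  constructor
  · rintro ⟨p, hp, rfl⟩
    refine ⟨p.swap, ?_, rfl⟩
    rw [← swap_mem_diffExponents_swap_iff, Prod.swap_swap]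
    exact hp
  · rintro ⟨p, hp, rfl⟩
    exact ⟨p.swap, swap_mem_diffExponents_swap hp, rfl⟩

lemma finite_diffExponents : ζ.diffExponents.Finite := by
  have h1 : ζ.diffExponents ⊆
      ⋃ h ∈ ζ.conjugates, {p | IsMonomialTimesUnit (h - ζ.H) p.1 p.2} := by
    rintro p ⟨ω, hω, h⟩
    exact Set.mem_biUnion (ζ.mem_conjugates.2 ⟨ω, hω, rfl⟩) h
  refine Set.Finite.subset (Set.Finite.biUnion ζ.conjugates.finite_toSet fun h _ => ?_) h1
  refine Set.Subsingleton.finite fun p hp q hq => ?_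
  have := IsMonomialTimesUnit.unique hp hq
  exact Prod.ext this.1 this.2

lemma HasMonomialDifferences.le_or_le (h : ζ.HasMonomialDifferences) {p q : ℕ × ℕ}
    (hp : p ∈ ζ.diffExponents) (hq : q ∈ ζ.diffExponents) : p ≤ q ∨ q ≤ p := by
  obtain ⟨ω, hω, hp⟩ := hp
  obtain ⟨τ, hτ, hq⟩ := hq
  exact hp.comparable hq (by
    rw [sub_sub_sub_cancel_right]
    exact h.sub (ζ.mem_conjugates.2 ⟨ω, hω, rfl⟩) (ζ.mem_conjugates.2 ⟨τ, hτ, rfl⟩))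

/-- The characteristic pairs form a chain, so they can be listed in increasing order. -/
lemma HasMonomialDifferences.exists_labeling (h : ζ.HasMonomialDifferences) :
    ∃ (s : ℕ) (lam mu : Fin s → ℚ), Monotone lam ∧ Monotone mu ∧
      Function.Injective (fun i => (lam i, mu i)) ∧
      Set.range (fun i => (lam i, mu i)) = ζ.charPairs := by
  classical
  let F : Finset (ℕ ×ₗ ℕ) := (finite_diffExponents (ζ := ζ)).toFinset.map toLex.toEmbedding
  have hF : ∀ p, p ∈ F ↔ ofLex p ∈ ζ.diffExponents := fun p => by
    simp only [F, Finset.mem_map, Set.Finite.mem_toFinset]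
    constructor
    · rintro ⟨q, hq, rfl⟩
      exact hq
    · exact fun hp => ⟨_, hp, rfl⟩
  let e := F.orderEmbOfFin rfl
  let f : Fin F.card → ℕ × ℕ := fun i => ofLex (e i)
  have hf : ∀ i, f i ∈ ζ.diffExponents := fun i => (hF _).1 (F.orderEmbOfFin_mem rfl i)
  have hmono : Monotone f := fun i j hij => by
    rcases h.le_or_le (hf i) (hf j) with h1 | h1
    · exact h1
    · have h2 : e j ≤ e i := Prod.Lex.toLex_mono h1
      have h3 : e i = e j := le_antisymm (e.monotone hij) h2
      exact (congrArg ofLex h3).le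
  have hinj : Function.Injective f := fun i j hij => e.injective hij
  have hpos : (0 : ℚ) ≤ ζ.n := Nat.cast_nonneg _
  refine ⟨F.card, fun i => (toPair ζ.n (f i)).1, fun i => (toPair ζ.n (f i)).2, fun i j hij => ?_,
    fun i j hij => ?_, fun i j hij => ?_, ?_⟩
  · exact div_le_div_of_nonneg_right (by exact_mod_cast (hmono hij).1) hpos
  · exact div_le_div_of_nonneg_right (by exact_mod_cast (hmono hij).2) hpos
  · exact hinj (toPair_injective ζ.n_ne_zero hij)
  · rw [charPairs_eq]
    ext q
    constructor
    · rintro ⟨i, rfl⟩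
      exact ⟨f i, hf i, rfl⟩
    · rintro ⟨p, hp, rfl⟩
      have : toLex p ∈ Set.range e := by
        rw [Finset.range_orderEmbOfFin]
        exact (hF _).2 hp
      obtain ⟨i, hi⟩ := this
      refine ⟨i, ?_⟩
      have : f i = p := congrArg ofLex hi
      simp only [this]

variable (ζ) in
/-- The conditions on the leading monomial of a normalized parametrization. -/
def HasNormalizedLeadingTerm : Prop :=
  ∃ a b : ℕ, IsMonomialTimesUnit ζ.H a b ∧ ¬ (ζ.n ∣ a ∧ ζ.n ∣ b) ∧ (a + b < ζ.n → 0 < a ∧ 0 < b)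

lemma HasNormalizedLeadingTerm.swap (h : ζ.HasNormalizedLeadingTerm) :
    ζ.swap.HasNormalizedLeadingTerm := by
  obtain ⟨a, b, h1, h2, h3⟩ := h
  refine ⟨b, a, isMonomialTimesUnit_swapSeries h1, fun h => h2 h.symm, fun h => ?_⟩
  have : a + b < ζ.n := by rw [add_comm]; exact h
  exact (h3 this).symm

/-- With the leading monomial in order, either `ζ` or its mirror image is normalized. -/
lemma HasMonomialDifferences.isNormalized_or_swap (h : ζ.HasMonomialDifferences)
    (hl : ζ.HasNormalizedLeadingTerm) : ζ.IsNormalized ∨ ζ.swap.IsNormalized := by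
  obtain ⟨s, lam, mu, hlam, hmu, hinj, hrange⟩ := h.exists_labeling
  rcases le_total (toLex mu) (toLex lam) with hle | hle
  · exact Or.inl ⟨hl, s, lam, mu, hlam, hmu, hinj, hrange, hle⟩
  · refine Or.inr ⟨hl.swap, s, mu, lam, hmu, hlam, fun i j hij => hinj ?_, ?_, hle⟩
    · simp only [Prod.mk.injEq] at hij ⊢
      exact hij.symm
    · rw [charPairs_swap, ← hrange, ← Set.range_comp]
      rfl

end FracSeries

/-- Exchanging `x` and `y` gives a parametrization of the mirror image. -/
lemma IsParametrization.swap {V : Set Space} {ζ : FracSeries} (h : IsParametrization V ζ) :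
    IsParametrization (swapXY '' V) ζ.swap := by
  rw [isParametrization_iff] at *
  obtain ⟨hH, ⟨h0, hM⟩, hV⟩ := h
  refine ⟨?_, ⟨?_, fun ω hω => ?_⟩, ?_⟩
  · obtain ⟨r, hr, h⟩ := convergent_iff.1 hH
    exact convergent_iff.2 ⟨r, hr, absConv_swapSeries h⟩
  · rw [FracSeries.swap_H, ← coeff_zero_eq_constantCoeff_apply, coeff_swapSeries]
    have : swapExpo 0 = 0 := by ext i; fin_cases i <;> simp
    rw [this, coeff_zero_eq_constantCoeff_apply, h0]
  · rw [FracSeries.rescale_swap_sub]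
    rcases hM ![ω 1, ω 0] (by simpa [Fin.forall_fin_two] using ⟨hω 1, hω 0⟩) with h | ⟨u, v, h⟩
    · left
      rw [h]
      exact map_zero _
    · exact Or.inr ⟨v, u, isMonomialTimesUnit_swapSeries h⟩
  · have hψ : Tendsto swapXY (𝓝 0) (𝓝 0) := analyticAt_swapXY.continuousAt.tendsto
    refine (image_eventuallyEq swapXY_swapXY swapXY_swapXY hψ hV).trans
      (Eventually.of_forall fun q => propext ?_)
    refine (Set.mem_image_iff_of_inverse swapXY_swapXY swapXY_swapXY).trans ?_
    have key : ∀ t s, value ζ.swap.H t s = value ζ.H s t := fun t s => by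
      rw [value_eq_evalAt, value_eq_evalAt, FracSeries.swap_H, evalAt_swapSeries]
    constructor
    · rintro ⟨t, s, ht, hs, hz⟩
      exact ⟨s, t, hs, ht, by rw [key]; exact hz⟩
    · rintro ⟨t, s, ht, hs, hz⟩
      exact ⟨s, t, hs, ht, by rw [← key]; exact hz⟩

/-- With the leading monomial in order, at most one exchange of `x` and `y` is needed. -/
lemma IsParametrization.exists_normalized {V : Set Space} {ζ : FracSeries}
    (h : IsParametrization V ζ) (hl : ζ.HasNormalizedLeadingTerm) :
    ∃ (V' : Set Space) (ζ' : FracSeries), Relation.ReflTransGen Step (V, ζ) (V', ζ') ∧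
      IsParametrization V' ζ' ∧ ζ'.IsNormalized := by
  rcases (isParametrization_iff.1 h).2.1.isNormalized_or_swap hl with hn | hn
  · exact ⟨V, ζ, .refl, h, hn⟩
  · exact ⟨_, _, .single (.exchangeXY V ζ h.swap), h.swap, hn⟩

end Swap

/-! ### Calculus of germs in two variables, and inversion -/

section Germs

open MvPowerSeries

/-- The convergent series `h` represents the germ of `F` at the origin of `ℂ²`. -/
def HasGerm (h : Series) (F : (Fin 2 → ℂ) → ℂ) : Prop :=
  Convergent h ∧ F =ᶠ[𝓝 0] evalAt h

lemma eventually_norm_le {κ : Type*} [Fintype κ] {r : ℝ} (hr : 0 < r) :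
    ∀ᶠ v in 𝓝 (0 : κ → ℂ), ∀ i, ‖v i‖ ≤ r := by
  filter_upwards [Metric.ball_mem_nhds (0 : κ → ℂ) hr] with v hv i
  exact (norm_le_pi_norm v i).trans (mem_ball_zero_iff.1 hv).le

lemma exists_hasGerm {F : (Fin 2 → ℂ) → ℂ} (hF : AnalyticAt ℂ F 0) : ∃ h, HasGerm h F := by
  obtain ⟨r, hr, h, hh, hFh⟩ := exists_absConv_of_analyticAt hF
  exact ⟨h, convergent_iff.2 ⟨r, hr, hh⟩, hFh⟩

lemma Convergent.hasGerm {h : Series} (hh : Convergent h) : HasGerm h (evalAt h) :=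
  ⟨hh, EventuallyEq.rfl⟩

namespace HasGerm

variable {g h : Series} {F G : (Fin 2 → ℂ) → ℂ}

lemma congr (hh : HasGerm h F) (hFG : G =ᶠ[𝓝 0] F) : HasGerm h G := ⟨hh.1, hFG.trans hh.2⟩

lemma analyticAt (hh : HasGerm h F) : AnalyticAt ℂ F 0 := by
  obtain ⟨⟨r, hr, h1⟩, h2⟩ := And.imp_left convergent_iff.1 hh
  exact (h1.analyticAt hr).congr h2.symm

lemma eq_zero (hh : HasGerm h F) (h0 : F =ᶠ[𝓝 0] 0) : h = 0 := by
  obtain ⟨⟨r, hr, h1⟩, h2⟩ := And.imp_left convergent_iff.1 hh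
  exact h1.eq_zero hr (h2.symm.trans h0)

lemma eventually_eq_zero (hh : HasGerm 0 F) : F =ᶠ[𝓝 0] 0 := by
  refine hh.2.trans (Eventually.of_forall fun v => ?_)
  simp [evalAt]

lemma sub (hg : HasGerm g G) (hh : HasGerm h F) : HasGerm (g - h) (fun v => G v - F v) := by
  refine ⟨hg.1.sub hh.1, ?_⟩
  obtain ⟨r, hr, hsub⟩ := hg.1.evalAt_sub hh.1
  filter_upwards [hg.2, hh.2, eventually_norm_le hr] with v h1 h2 h3
  rw [hsub v h3, h1, h2]

lemma mul (hg : HasGerm g G) (hh : HasGerm h F) : HasGerm (g * h) (fun v => G v * F v) := by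
  obtain ⟨⟨r, hr, hg1⟩, hg2⟩ := And.imp_left convergent_iff.1 hg
  obtain ⟨⟨r', hr', hh1⟩, hh2⟩ := And.imp_left convergent_iff.1 hh
  have h0 : 0 < min r r' := lt_min hr hr'
  have hg3 := hg1.mono h0.le (min_le_left _ _)
  have hh3 := hh1.mono h0.le (min_le_right _ _)
  refine ⟨convergent_iff.2 ⟨_, h0, hg3.mul h0.le hh3⟩, ?_⟩
  filter_upwards [hg2, hh2, eventually_norm_le h0] with v h1 h2 h3
  rw [hg3.evalAt_mul hh3 h3, h1, h2]

lemma const (c : ℂ) : HasGerm (C c) (fun _ => c) :=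
  ⟨convergent_iff.2 ⟨1, one_pos, absConv_C _ _⟩, Eventually.of_forall fun v => (evalAt_C c v).symm⟩

lemma coord (i : Fin 2) : HasGerm (X i) (fun v => v i) :=
  ⟨convergent_iff.2 ⟨1, one_pos, absConv_X _ _⟩, Eventually.of_forall fun v => (evalAt_X i v).symm⟩

lemma pow (hh : HasGerm h F) (k : ℕ) : HasGerm (h ^ k) (fun v => F v ^ k) := by
  induction k with
  | zero => simpa using const 1
  | succ k ih => simpa [pow_succ] using ih.mul hh

lemma unique (hg : HasGerm g F) (hh : HasGerm h F) : g = h := by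
  refine sub_eq_zero.1 ((hg.sub hh).eq_zero ?_)
  simp only [sub_self]
  rfl

lemma rescale (hh : HasGerm h F) {a : Fin 2 → ℂ} (ha : ∀ i, ‖a i‖ ≤ 1) :
    HasGerm (rescale a h) (fun v => F (a * v)) := by
  obtain ⟨⟨r, hr, h1⟩, h2⟩ := And.imp_left convergent_iff.1 hh
  refine ⟨convergent_iff.2 ⟨r, hr, h1.rescale hr.le ha⟩, ?_⟩
  have htend : Tendsto (fun v : Fin 2 → ℂ => a * v) (𝓝 0) (𝓝 0) := by
    have : Continuous fun v : Fin 2 → ℂ => a * v := by fun_prop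
    simpa using this.tendsto 0
  filter_upwards [htend.eventually h2] with v hv
  rw [hv, evalAt_rescale]

lemma apply_zero (hh : HasGerm h F) : F 0 = constantCoeff h := by
  rw [hh.2.self_of_nhds, evalAt_zero_right]

/-- On the level of germs, `IsMonomialTimesUnit` means the evident factorization. -/
lemma isMonomialTimesUnit_iff (hh : HasGerm h F) {u v : ℕ} : IsMonomialTimesUnit h u v ↔
    ∃ E : (Fin 2 → ℂ) → ℂ, AnalyticAt ℂ E 0 ∧ E 0 ≠ 0 ∧
      F =ᶠ[𝓝 0] fun w => w 0 ^ u * w 1 ^ v * E w := by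
  constructor
  · rintro ⟨ε, hε, rfl⟩
    have hconv : Convergent ε := by
      obtain ⟨r, hr, h1⟩ := convergent_iff.1 hh.1
      have cancel : ∀ (i : Fin 2) (k : ℕ) (g : Series), AbsConv r (X i ^ k * g) → AbsConv r g :=
          fun i k g => by
        induction k with
        | zero => simp
        | succ k ih =>
          intro H
          rw [pow_succ', mul_assoc] at H
          exact ih (H.of_X_mul hr)
      rw [mul_assoc] at h1
      exact convergent_iff.2 ⟨r, hr, cancel 1 v _ (cancel 0 u _ h1)⟩
    refine ⟨evalAt ε, hconv.hasGerm.analyticAt, by rwa [evalAt_zero_right], ?_⟩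
    have h2 := (((coord 0).pow u).mul ((coord 1).pow v)).mul hconv.hasGerm
    exact hh.2.trans h2.2.symm
  · rintro ⟨E, hE, hE0, hF⟩
    obtain ⟨ε, hε⟩ := exists_hasGerm hE
    refine ⟨ε, by rwa [← hε.apply_zero], ?_⟩
    have h2 := (((coord 0).pow u).mul ((coord 1).pow v)).mul hε
    exact hh.unique (h2.congr hF)

end HasGerm

end Germs

section Inversion

lemma analyticAt_coord {κ : Type*} [Fintype κ] (i : κ) (e : κ → ℂ) :
    AnalyticAt ℂ (fun v : κ → ℂ => v i) e :=
  (ContinuousLinearMap.proj (R := ℂ) (φ := fun _ : κ => ℂ) i).analyticAt e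

lemma vec_zero : (![0, 0] : Fin 2 → ℂ) = 0 := by
  ext i; fin_cases i <;> rfl

/-- The analytic inverse function theorem for `(t, s) ↦ (t g(t, s), s)` with `g(0, 0) ≠ 0`. -/
lemma exists_inverse {g : (Fin 2 → ℂ) → ℂ} (hg : AnalyticAt ℂ g 0) (hg0 : g 0 ≠ 0) :
    ∃ T : (Fin 2 → ℂ) → ℂ, AnalyticAt ℂ T 0 ∧ T 0 = 0 ∧
      (∀ᶠ v in 𝓝 (0 : Fin 2 → ℂ), T ![v 0 * g v, v 1] = v 0) ∧
      ∀ᶠ w in 𝓝 (0 : Fin 2 → ℂ), T w * g ![T w, w 1] = w 0 := by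
  set Φ : (Fin 2 → ℂ) → (Fin 2 → ℂ) := fun v => ![v 0 * g v, v 1] with hΦ
  have hΦa : AnalyticAt ℂ Φ 0 :=
    analyticAt_vec ((analyticAt_coord 0 0).mul hg) (analyticAt_coord 1 0)
  have hΦ0 : Φ 0 = 0 := by simp [hΦ]
  let L : (Fin 2 → ℂ) ≃L[ℂ] (Fin 2 → ℂ) := ContinuousLinearEquiv.piCongrRight fun i =>
    ContinuousLinearEquiv.unitsEquivAut ℂ (if i = 0 then Units.mk0 (g 0) hg0 else 1)
  have hL : HasFDerivAt Φ (L : (Fin 2 → ℂ) →L[ℂ] (Fin 2 → ℂ)) 0 := by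
    rw [hasFDerivAt_pi']
    intro i
    have hproj : ∀ j : Fin 2, HasFDerivAt (fun v : Fin 2 → ℂ => v j)
        (ContinuousLinearMap.proj (R := ℂ) (φ := fun _ : Fin 2 => ℂ) j) 0 := fun j =>
      (ContinuousLinearMap.proj (R := ℂ) (φ := fun _ : Fin 2 => ℂ) j).hasFDerivAt
    fin_cases i
    · have h1 := (hproj 0).mul hg.differentiableAt.hasFDerivAt
      refine h1.congr_fderiv ?_
      ext v
      simp [L, mul_comm]
    · refine (hproj 1).congr_fderiv ?_
      ext v
      simp [L]
  have hcd : ContDiffAt ℂ ⊤ Φ 0 := hΦa.contDiffAt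
  have hne : (⊤ : WithTop ℕ∞) ≠ 0 := by simp
  set Ψ := hcd.localInverse hL hne
  have hΨa : AnalyticAt ℂ Ψ 0 := by
    have := hcd.to_localInverse hL hne
    rw [hΦ0] at this
    exact this.analyticAt
  have hstrict := hcd.hasStrictFDerivAt' hL hne
  have hleft : ∀ᶠ v in 𝓝 (0 : Fin 2 → ℂ), Ψ (Φ v) = v := hstrict.eventually_left_inverse
  have hright : ∀ᶠ w in 𝓝 (0 : Fin 2 → ℂ), Φ (Ψ w) = w := by
    have := hstrict.eventually_right_inverse
    rwa [hΦ0] at this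
  refine ⟨fun w => Ψ w 0, (analyticAt_coord 0 _).fun_comp hΨa, ?_, ?_, ?_⟩
  · have := hleft.self_of_nhds
    rw [hΦ0] at this
    simp [this]
  · filter_upwards [hleft] with v hv
    exact congrFun hv 0
  · filter_upwards [hright] with w hw
    have h0 : Ψ w 0 * g (Ψ w) = w 0 := by simpa [hΦ] using congrFun hw 0
    have h1 : Ψ w 1 = w 1 := by simpa [hΦ] using congrFun hw 1
    have h2 : ![Ψ w 0, w 1] = Ψ w := by
      ext i; fin_cases i <;> simp [h1]
    rw [h2, h0]

/-- An analytic germ which does not vanish has analytic roots of every order. -/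
lemma exists_analyticAt_root {E : Type*} [NormedAddCommGroup E] [NormedSpace ℂ E] {F : E → ℂ}
    {e : E} (hF : AnalyticAt ℂ F e) (h0 : F e ≠ 0) {a : ℕ} (ha : a ≠ 0) :
    ∃ g : E → ℂ, AnalyticAt ℂ g e ∧ g e ≠ 0 ∧ ∀ v, g v ^ a = F v := by
  obtain ⟨c, hc⟩ := IsAlgClosed.exists_pow_nat_eq (F e) (Nat.pos_of_ne_zero ha)
  have hc0 : c ≠ 0 := by
    rintro rfl
    rw [zero_pow ha] at hc
    exact h0 hc.symm
  have key : ∀ v, (c * (F v / F e) ^ ((a : ℂ)⁻¹)) ^ a = F v := fun v => by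
    rw [mul_pow, Complex.cpow_nat_inv_pow _ ha, hc]
    field_simp
  refine ⟨fun v => c * (F v / F e) ^ ((a : ℂ)⁻¹), ?_, fun h => h0 ?_, key⟩
  · refine analyticAt_const.mul ((hF.div analyticAt_const h0).cpow analyticAt_const ?_)
    simp [h0]
  · rw [← key e]
    dsimp only at h
    rw [h, zero_pow ha]

/-- The difference quotient of an analytic germ in its first variable is analytic. -/
lemma exists_difference_quotient {P : (Fin 2 → ℂ) → ℂ} (hP : AnalyticAt ℂ P 0) :
    ∃ N : (Fin 3 → ℂ) → ℂ, AnalyticAt ℂ N 0 ∧ ∀ᶠ v in 𝓝 (0 : Fin 3 → ℂ),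
      P ![v 0 + v 2, v 1] - P ![v 0, v 1] = v 2 * N v := by
  have h1 : AnalyticAt ℂ (fun v : Fin 3 → ℂ => P ![v 0 + v 2, v 1]) 0 := by
    refine AnalyticAt.fun_comp (g := P) ?_
      (analyticAt_vec ((analyticAt_coord 0 0).add (analyticAt_coord 2 0)) (analyticAt_coord 1 0))
    simpa [vec_zero] using hP
  have h2 : AnalyticAt ℂ (fun v : Fin 3 → ℂ => P ![v 0, v 1]) 0 := by
    refine AnalyticAt.fun_comp (g := P) ?_
      (analyticAt_vec (analyticAt_coord 0 0) (analyticAt_coord 1 0))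
    simpa [vec_zero] using hP
  refine exists_eq_coord_mul (h1.sub h2) 2 (Eventually.of_forall fun v hv => ?_)
  simp [hv]

end Inversion

/-! ### Exchange of `x` and `z` -/

section Exchange

open MvPowerSeries

lemma analyticAt_vec_three {E : Type*} [NormedAddCommGroup E] [NormedSpace ℂ E] {a b c : E → ℂ}
    {e : E} (ha : AnalyticAt ℂ a e) (hb : AnalyticAt ℂ b e) (hc : AnalyticAt ℂ c e) :
    AnalyticAt ℂ (fun q => (![a q, b q, c q] : Fin 3 → ℂ)) e := by
  refine AnalyticAt.pi fun i => ?_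
  fin_cases i
  · exact ha
  · exact hb
  · exact hc

lemma vec_mul (a b : ℂ) (v : Fin 2 → ℂ) : (![a, b] : Fin 2 → ℂ) * v = ![a * v 0, b * v 1] := by
  ext i; fin_cases i <;> simp

lemma norm_vec_le_one {a b : ℂ} {m n : ℕ} (hm : m ≠ 0) (hn : n ≠ 0) (ha : a ^ m = 1)
    (hb : b ^ n = 1) : ∀ i, ‖(![a, b] : Fin 2 → ℂ) i‖ ≤ 1 := by
  rw [Fin.forall_fin_two]
  exact ⟨(Complex.norm_eq_one_of_pow_eq_one ha hm).le, (Complex.norm_eq_one_of_pow_eq_one hb hn).le⟩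

/-- The roots of unity in the ring of power series are the constant ones. -/
lemma exists_eq_C_of_pow_eq_one {n : ℕ} (hn : n ≠ 0) {η : Series} (h : η ^ n = 1) :
    ∃ γ : ℂ, γ ^ n = 1 ∧ η = C γ := by
  have : NeZero n := ⟨hn⟩
  have hp := Complex.isPrimitiveRoot_exp n hn
  have hp' := hp.map_of_injective (f := (C : ℂ →+* Series)) (MvPowerSeries.C_injective)
  obtain ⟨i, -, rfl⟩ := hp'.eq_pow_of_pow_eq_one h
  exact ⟨_, by rw [← pow_mul, mul_comm i n, pow_mul, hp.pow_eq_one, one_pow], (map_pow _ _ _).symm⟩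

/-- The difference of two `n`-th powers is the product of the differences twisted by roots of
unity. -/
lemma pow_sub_pow_eq_prod {n : ℕ} (hn : n ≠ 0) (g h : Series) :
    g ^ n - h ^ n = ∏ η ∈ Polynomial.nthRootsFinset n (1 : Series), (g - η * h) := by
  have hp := (Complex.isPrimitiveRoot_exp n hn).map_of_injective (f := (C : ℂ →+* Series))
    MvPowerSeries.C_injective
  exact hp.pow_sub_pow_eq_prod_sub_mul (x := g) (y := h) (Nat.pos_of_ne_zero hn)

/-- The local situation in which `x` and `z` are exchanged: `(t, s) ↦ (t g(t, s), s)` and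
`(w, s) ↦ (T(w, s), s)` are inverse to each other. -/
structure IsInversePair (g T : (Fin 2 → ℂ) → ℂ) : Prop where
  analyticAt_g : AnalyticAt ℂ g 0
  g_zero : g 0 ≠ 0
  analyticAt_T : AnalyticAt ℂ T 0
  T_zero : T 0 = 0
  left_inv : ∀ᶠ v in 𝓝 (0 : Fin 2 → ℂ), T ![v 0 * g v, v 1] = v 0
  right_inv : ∀ᶠ w in 𝓝 (0 : Fin 2 → ℂ), T w * g ![T w, w 1] = w 0

namespace IsInversePair

variable {g T : (Fin 2 → ℂ) → ℂ}

lemma analyticAt_P (hp : IsInversePair g T) : AnalyticAt ℂ (fun v => v 0 * g v) 0 :=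
  (analyticAt_coord 0 0).mul hp.analyticAt_g

lemma analyticAt_inv (hp : IsInversePair g T) :
    AnalyticAt ℂ (fun w => (![T w, w 1] : Fin 2 → ℂ)) 0 :=
  analyticAt_vec hp.analyticAt_T (analyticAt_coord 1 0)

lemma inv_zero (hp : IsInversePair g T) : (![T 0, (0 : Fin 2 → ℂ) 1] : Fin 2 → ℂ) = 0 := by
  rw [hp.T_zero]
  exact vec_zero

lemma tendsto_inv (hp : IsInversePair g T) :
    Tendsto (fun w => (![T w, w 1] : Fin 2 → ℂ)) (𝓝 0) (𝓝 0) := by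
  have := hp.analyticAt_inv.continuousAt.tendsto
  rwa [hp.inv_zero] at this

/-- `T(w, s)` is `w` times a unit. -/
lemma exists_T_eq (hp : IsInversePair g T) : ∃ k : (Fin 2 → ℂ) → ℂ, AnalyticAt ℂ k 0 ∧ k 0 ≠ 0 ∧
    T =ᶠ[𝓝 0] fun w => w 0 * k w := by
  have hg : AnalyticAt ℂ (fun w => g ![T w, w 1]) 0 :=
    AnalyticAt.fun_comp (g := g) (by rw [hp.inv_zero]; exact hp.analyticAt_g) hp.analyticAt_inv
  have hg0 : g ![T 0, (0 : Fin 2 → ℂ) 1] ≠ 0 := by rw [hp.inv_zero]; exact hp.g_zero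
  refine ⟨fun w => (g ![T w, w 1])⁻¹, hg.inv hg0, inv_ne_zero hg0, ?_⟩
  filter_upwards [hp.right_inv, hg.continuousAt.eventually_ne hg0] with w h1 h2
  rw [← h1]
  field_simp

/-- A germ whose pullback under `(t, s) ↦ (t g(t, s), s)` is a monomial times a unit has itself
this property. -/
lemma zeroOrMonomial_of_comp (hp : IsInversePair g T) {Dh Fh : Series} {D F : (Fin 2 → ℂ) → ℂ}
    (hD : HasGerm Dh D) (hF : HasGerm Fh F) (hDF : ∀ᶠ w in 𝓝 (0 : Fin 2 → ℂ), D ![T w, w 1] = F w)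
    (h : ZeroOrMonomial Dh) : ZeroOrMonomial Fh := by
  rcases h with rfl | ⟨u, v, huv⟩
  · refine Or.inl (hF.eq_zero ?_)
    filter_upwards [hDF, hp.tendsto_inv.eventually hD.eventually_eq_zero] with w h1 h2
    rw [← h1, h2]
    rfl
  · obtain ⟨E, hE, hE0, hDE⟩ := hD.isMonomialTimesUnit_iff.1 huv
    obtain ⟨k, hk, hk0, hTk⟩ := hp.exists_T_eq
    refine Or.inr ⟨u, v, hF.isMonomialTimesUnit_iff.2
      ⟨fun w => k w ^ u * E ![T w, w 1], ?_, ?_, ?_⟩⟩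
    · exact (hk.pow u).mul
        (AnalyticAt.fun_comp (g := E) (by rw [hp.inv_zero]; exact hE) hp.analyticAt_inv)
    · dsimp only
      rw [hp.inv_zero]
      exact mul_ne_zero (pow_ne_zero _ hk0) hE0
    · filter_upwards [hDF, hp.tendsto_inv.eventually hDE, hTk] with w h1 h2 h3
      rw [← h1, h2]
      simp only [Matrix.cons_val_zero, Matrix.cons_val_one]
      rw [h3]
      ring

/-- If `H = (t g)^a` and `H(γt, βs) - H(t, s)` is a monomial times a unit or zero, then so is
`T(αw, βs) - γ T(w, s)` for every `a`-th root of unity `α`. After the substitution `w = t g(t, s)`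
this difference divides `α P(t, s) - P(γt, βs)` with `P = t g`, which in turn divides
`H(t, s) - H(γt, βs)`. -/
lemma zeroOrMonomial_rescale_sub (hp : IsInversePair g T) {a n : ℕ} (ha : a ≠ 0) (hn : n ≠ 0)
    {H Th : Series} (hH : HasGerm H fun v => (v 0 * g v) ^ a) (hT : HasGerm Th T) {α β γ : ℂ}
    (hα : α ^ a = 1) (hβ : β ^ n = 1) (hγ : γ ^ n = 1)
    (hdiff : ZeroOrMonomial (rescale ![γ, β] H - H)) :
    ZeroOrMonomial (rescale ![α, β] Th - C γ * Th) := by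
  set P : (Fin 2 → ℂ) → ℂ := fun v => v 0 * g v with hP
  have hγβ := norm_vec_le_one hn hn hγ hβ
  have hαβ := norm_vec_le_one ha hn hα hβ
  obtain ⟨Ph, hPh⟩ := exists_hasGerm hp.analyticAt_P
  have hPa : Ph ^ a = H := (hPh.pow a).unique hH
  have hP0 : P 0 = 0 := by simp [hP]
  -- The point `(α P(t, s), β s)`, at which `T` is evaluated.
  have hW : AnalyticAt ℂ (fun v : Fin 2 → ℂ => (![α * P v, β * v 1] : Fin 2 → ℂ)) 0 :=
    analyticAt_vec (analyticAt_const.mul hp.analyticAt_P)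
      (analyticAt_const.mul (analyticAt_coord 1 0))
  have hW0 : (![α * P 0, β * (0 : Fin 2 → ℂ) 1] : Fin 2 → ℂ) = 0 := by
    rw [hP0]; simp
  have hWt : Tendsto (fun v : Fin 2 → ℂ => (![α * P v, β * v 1] : Fin 2 → ℂ)) (𝓝 0) (𝓝 0) := by
    have := hW.continuousAt.tendsto
    rwa [hW0] at this
  set D : (Fin 2 → ℂ) → ℂ := fun v => T ![α * P v, β * v 1] - γ * v 0 with hD
  have hDa : AnalyticAt ℂ D 0 :=
    (AnalyticAt.fun_comp (g := T) (by rw [hW0]; exact hp.analyticAt_T) hW).sub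
      (analyticAt_const.mul (analyticAt_coord 0 0))
  have hD0 : D 0 = 0 := by
    simp only [hD]
    rw [hW0, hp.T_zero]
    simp
  obtain ⟨Dh, hDh⟩ := exists_hasGerm hDa
  have hγt : Tendsto (fun v : Fin 2 → ℂ => ![γ, β] * v) (𝓝 0) (𝓝 0) := by
    have : Continuous fun v : Fin 2 → ℂ => ![γ, β] * v := by fun_prop
    simpa using this.tendsto 0
  -- `N` is the difference quotient of `P` between the points `γ t` and `γ t + D`.
  obtain ⟨N, hN, hPN⟩ := exists_difference_quotient hp.analyticAt_P
  have hU : AnalyticAt ℂ (fun v : Fin 2 → ℂ => (![γ * v 0, β * v 1, D v] : Fin 3 → ℂ)) 0 :=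
    analyticAt_vec_three (analyticAt_const.mul (analyticAt_coord 0 0))
      (analyticAt_const.mul (analyticAt_coord 1 0)) hDa
  have hU0 : (![γ * (0 : Fin 2 → ℂ) 0, β * (0 : Fin 2 → ℂ) 1, D 0] : Fin 3 → ℂ) = 0 := by
    rw [hD0]; ext i; fin_cases i <;> simp
  have hUt : Tendsto (fun v : Fin 2 → ℂ => (![γ * v 0, β * v 1, D v] : Fin 3 → ℂ))
      (𝓝 0) (𝓝 0) := by
    have := hU.continuousAt.tendsto
    rwa [hU0] at this
  obtain ⟨Nh, hNh⟩ := exists_hasGerm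
    (AnalyticAt.fun_comp (g := N) (f := fun v : Fin 2 → ℂ => ![γ * v 0, β * v 1, D v])
      (x := 0) (by rw [hU0]; exact hN) hU)
  have hEh : HasGerm (C α * Ph - rescale ![γ, β] Ph) (fun v => α * P v - P (![γ, β] * v)) :=
    ((HasGerm.const α).mul hPh).sub (hPh.rescale hγβ)
  -- Since `P(T(αP, βs), βs) = αP`, the difference `D` divides `α P(t, s) - P(γt, βs)`.
  have hDN : Dh * Nh = C α * Ph - rescale ![γ, β] Ph := by
    refine (hDh.mul hNh).unique (hEh.congr ?_)
    filter_upwards [hUt.eventually hPN, hWt.eventually hp.right_inv] with v h1 h2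
    simp only [Matrix.cons_val_zero, Matrix.cons_val_one, Matrix.cons_val] at h1 h2
    rw [← h1, vec_mul]
    have h3 : γ * v 0 + D v = T ![α * P v, β * v 1] := by simp [hD]
    simp only [hP, Matrix.cons_val_zero]
    rw [h3, h2]
  have hDz : ZeroOrMonomial Dh := by
    rcases hdiff with h0 | ⟨u, v, huv⟩
    · rw [← hPa, map_pow, pow_sub_pow_eq_prod ha] at h0
      obtain ⟨η, hη, h0⟩ := Finset.prod_eq_zero_iff.1 h0
      rw [Polynomial.mem_nthRootsFinset (Nat.pos_of_ne_zero ha)] at hη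
      obtain ⟨δ, -, rfl⟩ := exists_eq_C_of_pow_eq_one ha hη
      have hEδ : C α * Ph - rescale ![γ, β] Ph = C (α - δ) * Ph := by
        rw [sub_eq_zero.1 h0, map_sub, sub_mul]
      by_cases hαδ : α = δ
      · -- Here `P(γt, βs) = α P(t, s)`, and applying `T` gives `D = 0`.
        rw [hEδ, hαδ, sub_self, map_zero, zero_mul] at hEh
        refine Or.inl (hDh.eq_zero ?_)
        filter_upwards [hEh.eventually_eq_zero, hγt.eventually hp.left_inv] with v h1 h2
        have h3 : δ * P v = P (![γ, β] * v) := sub_eq_zero.1 h1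
        simp only [hD, Pi.zero_apply, hαδ]
        rw [h3, sub_eq_zero]
        simpa [hP] using h2
      · -- Here `P(γt, βs)` is another multiple `δ P(t, s)`, and `D` divides `(α - δ) P`.
        have hPm : IsMonomialTimesUnit Ph 1 0 := hPh.isMonomialTimesUnit_iff.2
          ⟨g, hp.analyticAt_g, hp.g_zero, Eventually.of_forall fun v => by simp⟩
        have hm := (isMonomialTimesUnit_of_unit (g := C (α - δ))
          (by simpa using sub_ne_zero.2 hαδ)).mul hPm
        rw [← hEδ, ← hDN] at hm
        exact Or.inr hm.of_mul
    · -- Here `D` divides the monomial times a unit `H(γt, βs) - H(t, s)`.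
      obtain ⟨c, hc⟩ := sub_dvd_pow_sub_pow (rescale ![γ, β] Ph) (C α * Ph) a
      rw [mul_pow, ← map_pow, ← map_pow, hα, map_one, one_mul, hPa] at hc
      rw [hc, ← neg_sub, neg_mul, ← mul_neg, ← hDN, mul_assoc] at huv
      exact Or.inr huv.of_mul
  refine hp.zeroOrMonomial_of_comp hDh
    ((hT.rescale hαβ).sub ((HasGerm.const γ).mul hT)) ?_ hDz
  filter_upwards [hp.right_inv] with w hw
  simp only [hD, hP, Matrix.cons_val_zero, Matrix.cons_val_one, vec_mul]
  rw [hw]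

lemma zeroOrMonomial_rescale_pow_sub_pow (hp : IsInversePair g T) {a n : ℕ} (ha : a ≠ 0)
    (hn : n ≠ 0) {H Th : Series} (hH : HasGerm H fun v => (v 0 * g v) ^ a) (hT : HasGerm Th T)
    (hdiff : ∀ ω : Fin 2 → ℂ, (∀ i, ω i ^ n = 1) → ZeroOrMonomial (rescale ω H - H)) {α β : ℂ}
    (hα : α ^ a = 1) (hβ : β ^ n = 1) :
    ZeroOrMonomial (rescale ![α, β] Th ^ n - Th ^ n) := by
  rw [pow_sub_pow_eq_prod hn]
  refine Finset.prod_induction _ ZeroOrMonomial (fun _ _ => ZeroOrMonomial.mul)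
    (Or.inr ⟨0, 0, isMonomialTimesUnit_of_unit (by simp)⟩) fun η hη => ?_
  rw [Polynomial.mem_nthRootsFinset (Nat.pos_of_ne_zero hn)] at hη
  obtain ⟨γ, hγ, rfl⟩ := exists_eq_C_of_pow_eq_one hn hη
  exact hp.zeroOrMonomial_rescale_sub ha hn hH hT hα hβ hγ
    (hdiff _ (by simpa [Fin.forall_fin_two] using ⟨hγ, hβ⟩))

end IsInversePair

/-- The `n`-th roots of the coordinates of a point near the origin are near the origin. -/
lemma eventually_roots_mem {U : Set (Fin 2 → ℂ)} (hU : U ∈ 𝓝 0) (n : ℕ) :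
    ∀ᶠ p in 𝓝 (0 : ℂ × ℂ), ∀ t s : ℂ, t ^ n = p.1 → s ^ n = p.2 → ![t, s] ∈ U := by
  obtain ⟨δ, hδ, hball⟩ := Metric.mem_nhds_iff.1 hU
  filter_upwards [Metric.ball_mem_nhds (0 : ℂ × ℂ) (pow_pos hδ n)] with p hp t s ht hs
  have hp' : ‖p‖ < δ ^ n := by simpa using hp
  refine hball (mem_ball_zero_iff.2 ((pi_norm_lt_iff hδ).2 ?_))
  rw [Fin.forall_fin_two]
  constructor
  · have := (norm_fst_le p).trans_lt hp'
    rw [← ht, norm_pow] at this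
    exact lt_of_pow_lt_pow_left₀ n hδ.le this
  · have := (norm_snd_le p).trans_lt hp'
    rw [← hs, norm_pow] at this
    exact lt_of_pow_lt_pow_left₀ n hδ.le this

/-- If the leading monomial of `ζ` is a power of `x^{1/n}` alone, the germ obtained by exchanging
`x` and `z` has a parametrization, found by solving `z = ζ(x, y)` for `x`: with
`z = (t g(t, s))^a`, `x = t^n`, `y = s^n` and `T` the inverse of `t g` in the first variable, it is
`x = T(z^{1/a}, y^{1/n})^n`. -/
theorem IsParametrization.exists_exchange {V : Set Space} {ζ : FracSeries}
    (h : IsParametrization V ζ) {a : ℕ} (ha : a ≠ 0) (hm : IsMonomialTimesUnit ζ.H a 0) :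
    ∃ ζ' : FracSeries, IsParametrization (swapXZ '' V) ζ' ∧ ζ'.n = a * ζ.n ∧
      ∀ d, coeff d ζ'.H ≠ 0 → ζ.n * ζ.n ≤ d 0 := by
  obtain ⟨hH, ⟨-, hM⟩, hV⟩ := isParametrization_iff.1 h
  have hn := ζ.n_ne_zero
  set n := ζ.n with hn_def
  obtain ⟨G, hG, hG0, hHG⟩ := hH.hasGerm.isMonomialTimesUnit_iff.1 hm
  obtain ⟨g, hg, hg0, hga⟩ := exists_analyticAt_root hG hG0 ha
  obtain ⟨T, hT, hT0, hl, hr⟩ := exists_inverse hg hg0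
  have hp : IsInversePair g T := ⟨hg, hg0, hT, hT0, hl, hr⟩
  obtain ⟨Th, hTh⟩ := exists_hasGerm hT
  obtain ⟨k, hk, hk0, hTk⟩ := hp.exists_T_eq
  have hHP : HasGerm ζ.H fun v => (v 0 * g v) ^ a := by
    refine hH.hasGerm.congr ?_
    filter_upwards [hHG] with v hv
    rw [hv, mul_pow, hga, pow_zero, mul_one]
  -- The substitution `w = W ^ n`, `s = S ^ a`.
  set R : (Fin 2 → ℂ) → (Fin 2 → ℂ) := fun v => ![v 0 ^ n, v 1 ^ a] with hR
  have hRa : AnalyticAt ℂ R 0 :=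
    analyticAt_vec ((analyticAt_coord 0 0).pow n) ((analyticAt_coord 1 0).pow a)
  have hR0 : R 0 = 0 := by
    simp only [hR, Pi.zero_apply, zero_pow hn, zero_pow ha]
    exact vec_zero
  have hRt : Tendsto R (𝓝 0) (𝓝 0) := by
    have := hRa.continuousAt.tendsto
    rwa [hR0] at this
  have hcomp : ∀ {F : (Fin 2 → ℂ) → ℂ}, AnalyticAt ℂ F 0 → AnalyticAt ℂ (fun v => F (R v)) 0 :=
    fun {F} hF => AnalyticAt.fun_comp (g := F) (by rw [hR0]; exact hF) hRa
  obtain ⟨H', hH'⟩ := exists_hasGerm ((hcomp hT).pow n)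
  have hN : a * n ≠ 0 := mul_ne_zero ha hn
  have hH'm : IsMonomialTimesUnit H' (n * n) 0 := hH'.isMonomialTimesUnit_iff.2
    ⟨fun v => k (R v) ^ n, (hcomp hk).pow n, by dsimp only; rw [hR0]; exact pow_ne_zero _ hk0, by
      filter_upwards [hRt.eventually hTk] with v hv
      simp only [Pi.pow_apply]
      rw [hv]
      simp only [hR, Matrix.cons_val_zero]
      ring⟩
  refine ⟨⟨a * n, hN, H'⟩, isParametrization_iff.2 ⟨hH'.1, ⟨?_, fun ω hω => ?_⟩, ?_⟩, rfl,
    fun d hd => ((isMonomialTimesUnit_iff.1 hH'm).2 d hd).1⟩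
  · rw [← hH'.apply_zero]
    simp only [Pi.pow_apply]
    rw [hR0, hT0, zero_pow hn]
  · -- The differences of conjugates are those of `T ^ n`, after the substitution.
    have hω' : ∀ i, ω i ^ (a * n) = 1 := hω
    have hα : (ω 0 ^ n) ^ a = 1 := by rw [← pow_mul, mul_comm, hω']
    have hβ : (ω 1 ^ a) ^ n = 1 := by rw [← pow_mul, hω']
    have hQ := hp.zeroOrMonomial_rescale_pow_sub_pow ha hn hHP hTh hM hα hβ
    have hQg := (((hTh.rescale (norm_vec_le_one ha hn hα hβ)).pow n).sub (hTh.pow n))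
    have hdiff := (hH'.rescale fun i =>
      (Complex.norm_eq_one_of_pow_eq_one (hω' i) hN).le).sub hH'
    have hRω : ∀ v, R (ω * v) = ![ω 0 ^ n, ω 1 ^ a] * R v := fun v => by
      rw [vec_mul]
      simp [hR, mul_pow]
    rcases hQ with h0 | ⟨u, v, huv⟩
    · refine Or.inl (hdiff.eq_zero ?_)
      rw [h0] at hQg
      filter_upwards [hRt.eventually hQg.eventually_eq_zero] with v hv
      simp only [Pi.pow_apply, hRω]
      exact hv
    · obtain ⟨E, hE, hE0, hEq⟩ := hQg.isMonomialTimesUnit_iff.1 huv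
      refine Or.inr ⟨n * u, a * v, hdiff.isMonomialTimesUnit_iff.2
        ⟨fun v => E (R v), hcomp hE, by dsimp only; rw [hR0]; exact hE0, ?_⟩⟩
      filter_upwards [hRt.eventually hEq] with w hw
      simp only [Pi.pow_apply, hRω]
      rw [hw]
      simp [hR, pow_mul]
  · have hψ : Tendsto swapXZ (𝓝 0) (𝓝 0) := analyticAt_swapXZ.continuousAt.tendsto
    refine (image_eventuallyEq swapXZ_swapXZ swapXZ_swapXZ hψ hV).trans ?_
    have hzy : Tendsto (fun q : Space => (q.2.2, q.2.1)) (𝓝 0) (𝓝 0) :=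
      (analyticAt_z.prod analyticAt_y).continuousAt.tendsto
    have hxy : Tendsto (fun q : Space => (q.1, q.2.1)) (𝓝 0) (𝓝 0) :=
      (analyticAt_x.prod analyticAt_y).continuousAt.tendsto
    have hinv : ∀ᶠ w in 𝓝 (0 : Fin 2 → ℂ),
        (T w * g ![T w, w 1]) ^ a = evalAt ζ.H ![T w, w 1] := by
      filter_upwards [hp.tendsto_inv.eventually hHP.2] with w hw
      simpa using hw
    filter_upwards [hzy.eventually (eventually_roots_mem (inter_mem hHP.2 hl) n),
      hxy.eventually (eventually_roots_mem (inter_mem hH'.2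
        (inter_mem (hRt hr) (hRt hinv))) (a * n))] with q hq1 hq2
    have key : ∀ W S : ℂ, W ^ (a * n) = q.1 → S ^ (a * n) = q.2.1 →
        value H' W S = T ![W ^ n, S ^ a] ^ n := fun W S hW hS => by
      have h1 : _ = evalAt H' ![W, S] := (hq2 W S hW hS).1
      rw [value_eq_evalAt, ← h1]
      simp [hR]
    refine propext ((Set.mem_image_iff_of_inverse swapXZ_swapXZ swapXZ_swapXZ).trans ?_)
    constructor
    · rintro ⟨t, s, ht, hs, hz⟩
      obtain ⟨h1, h2⟩ := hq1 t s ht hs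
      have h1' : (t * g ![t, s]) ^ a = value ζ.H t s := by
        rw [value_eq_evalAt]; exact h1
      have h2' : T ![t * g ![t, s], s] = t := h2
      obtain ⟨W, hW⟩ := IsAlgClosed.exists_pow_nat_eq (t * g ![t, s]) (Nat.pos_of_ne_zero hn)
      obtain ⟨S, hS⟩ := IsAlgClosed.exists_pow_nat_eq s (Nat.pos_of_ne_zero ha)
      have hWx : W ^ (a * n) = q.1 := by
        rw [mul_comm, pow_mul, hW, h1', hz]
        rfl
      have hSy : S ^ (a * n) = q.2.1 := by
        rw [pow_mul, hS]
        exact hs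
      refine ⟨W, S, hWx, hSy, ?_⟩
      rw [key W S hWx hSy, hW, hS, h2']
      exact ht
    · rintro ⟨W, S, hW, hS, hz⟩
      obtain ⟨-, h2, h3⟩ := hq2 W S hW hS
      have h2' : T ![W ^ n, S ^ a] * g ![T ![W ^ n, S ^ a], S ^ a] = W ^ n := h2
      have h3' : (T ![W ^ n, S ^ a] * g ![T ![W ^ n, S ^ a], S ^ a]) ^ a =
          evalAt ζ.H ![T ![W ^ n, S ^ a], S ^ a] := h3
      refine ⟨T ![W ^ n, S ^ a], S ^ a, ?_, ?_, ?_⟩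
      · rw [← hn_def, ← key W S hW hS]
        exact hz
      · rw [← hn_def, ← pow_mul]
        exact hS
      · rw [value_eq_evalAt, ← h3', h2', ← pow_mul, mul_comm]
        exact hW

end Exchange

/-! ### Normalization -/

section Normalization

open MvPowerSeries

/-- A non-smooth germ whose parametrization starts with `x^{a/n}`, `a < n`, can be normalized by
exchanging `x` and `z`: the new parametrization has only terms with exponent of `x` at least
`n / a > 1`, which remains true after subtracting its integral part. -/
lemma IsParametrization.exists_normalized_of_lt {V : Set Space} {ζ : FracSeries}
    (h : IsParametrization V ζ) (hsing : ¬ IsSmoothGerm V) {a : ℕ} (ha : a ≠ 0) (han : a < ζ.n)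
    (hm : IsMonomialTimesUnit ζ.H a 0) :
    ∃ (V' : Set Space) (ζ' : FracSeries), Relation.ReflTransGen Step (V, ζ) (V', ζ') ∧
      IsParametrization V' ζ' ∧ ζ'.IsNormalized := by
  obtain ⟨ζ₁, h₁, hn₁, hd₁⟩ := h.exists_exchange ha hm
  have hsing₁ : ¬ IsSmoothGerm (swapXZ '' V) := fun hs => hsing
    (hs.of_image swapXZ_swapXZ swapXZ_swapXZ analyticAt_swapXZ analyticAt_swapXZ rfl)
  have h₂ := h₁.subIntegralPart
  obtain ⟨u, v, huv, hdvd⟩ :=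
    (isParametrization_iff.1 h₂).2.1.exists_isMonomialTimesUnit
      (fun h0 => hsing₁ (h₁.isSmoothGerm h0)) coeff_subIntegralPart
  have hu : ζ.n * ζ.n ≤ u := by
    have hc := (QuasiOrdinary.isMonomialTimesUnit_iff.1 huv).1
    -- The exponent `(u, v)` is not integral, so the term is one of `ζ₁` itself.
    have hrange : expo u v ∉ Set.range fun d : Fin 2 →₀ ℕ => ζ₁.n • d := by
      rintro ⟨d, hd⟩
      rw [← hd] at hc
      exact hc (coeff_subIntegralPart d)
    have hc' : coeff (expo u v)
        (ζ₁.H - expand ζ₁.n ζ₁.n_ne_zero ζ₁.integralPart) ≠ 0 := hc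
    rw [map_sub, coeff_expand_of_not_mem_range ζ₁.n_ne_zero _ hrange, sub_zero] at hc'
    simpa using hd₁ _ hc'
  have hlt : ζ₁.n < ζ.n * ζ.n := by
    rw [hn₁]
    exact Nat.mul_lt_mul_of_pos_right han (Nat.pos_of_ne_zero ζ.n_ne_zero)
  obtain ⟨V', ζ', hstep, hζ', hnorm⟩ := h₂.exists_normalized
    ⟨u, v, huv, hdvd, fun hsum => absurd (show u + v < ζ₁.n from hsum) (by omega)⟩
  exact ⟨V', ζ', .head (.exchangeXZ V ζ ζ₁ h₁) (.head (.subtract _ ζ₁ h₂) hstep), hζ', hnorm⟩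

end Normalization

end QuasiOrdinary

end

theorem mainTheorem3 (V : Set QuasiOrdinary.Space) (ζ : QuasiOrdinary.FracSeries)
    (hζ : QuasiOrdinary.IsParametrization V ζ)
    (hsing : ¬ QuasiOrdinary.IsSmoothGerm V) :
    ∃ (V' : Set QuasiOrdinary.Space) (ζ' : QuasiOrdinary.FracSeries),
      Relation.ReflTransGen QuasiOrdinary.Step (V, ζ) (V', ζ') ∧
      QuasiOrdinary.IsParametrization V' ζ' ∧
      ζ'.IsNormalized := by
  have h₁ := hζ.subIntegralPart
  have hstep₁ := QuasiOrdinary.Step.subtract V ζ h₁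
  obtain ⟨hH, hM, -⟩ := QuasiOrdinary.isParametrization_iff.1 hζ
  have hp := QuasiOrdinary.convergent_integralPart hH
  have hp0 := QuasiOrdinary.constantCoeff_integralPart hM.1
  have hsing₁ : ¬ QuasiOrdinary.IsSmoothGerm (QuasiOrdinary.shear ζ.integralPart '' V) :=
    fun hs => hsing (hs.of_image (QuasiOrdinary.leftInverse_shear _)
      (QuasiOrdinary.rightInverse_shear _) (QuasiOrdinary.analyticAt_shear hp)
      (QuasiOrdinary.analyticAt_unshear hp)
      (by simp [QuasiOrdinary.shear, QuasiOrdinary.value_zero, hp0]))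
  obtain ⟨a, b, hab, hdvd⟩ :=
    (QuasiOrdinary.isParametrization_iff.1 h₁).2.1.exists_isMonomialTimesUnit
      (fun h0 => hsing (hζ.isSmoothGerm h0)) QuasiOrdinary.coeff_subIntegralPart
  by_cases hcond : a + b < ζ.subIntegralPart.n → 0 < a ∧ 0 < b
  · obtain ⟨V', ζ', hs, h', hn⟩ := h₁.exists_normalized ⟨a, b, hab, hdvd, hcond⟩
    exact ⟨V', ζ', .head hstep₁ hs, h', hn⟩
  push Not at hcond
  obtain ⟨hlt, hzero⟩ := hcond
  rcases Nat.eq_zero_or_pos a with rfl | ha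
  · -- The exponent of `x` vanishes; `x` and `y` are exchanged first.
    have hb : b ≠ 0 := by
      rintro rfl
      exact hdvd ⟨dvd_zero _, dvd_zero _⟩
    have h₂ := h₁.swap
    have hsing₂ : ¬ QuasiOrdinary.IsSmoothGerm
        (QuasiOrdinary.swapXY '' (QuasiOrdinary.shear ζ.integralPart '' V)) := fun hs => hsing₁
      (hs.of_image QuasiOrdinary.swapXY_swapXY QuasiOrdinary.swapXY_swapXY
        QuasiOrdinary.analyticAt_swapXY QuasiOrdinary.analyticAt_swapXY rfl)
    obtain ⟨V', ζ', hs, h', hn⟩ := h₂.exists_normalized_of_lt hsing₂ hb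
      (by rw [zero_add] at hlt; exact hlt) (QuasiOrdinary.isMonomialTimesUnit_swapSeries hab)
    exact ⟨V', ζ', .head hstep₁ (.head (.exchangeXY _ _ h₂) hs), h', hn⟩
  · obtain rfl : b = 0 := Nat.le_zero.1 (hzero ha)
    obtain ⟨V', ζ', hs, h', hn⟩ := h₁.exists_normalized_of_lt hsing₁ ha.ne' (by simpa using hlt) hab
    exact ⟨V', ζ', .head hstep₁ hs, h', hn⟩
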